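/- Let $\mathbb D=\{z\in\mathbb C:|z|<1\}$. Let $\Omega\subset\mathbb C$ be a convex domain with $1\in\Omega$, and let $P$ be a conformal map of $\mathbb D$ onto $\Omega$ with $P(z)=1+\alpha_1z+\cdots$. Let $\mathcal{CV}(\Omega)$ be the class of analytic functions $f$ in $\mathbb D$ with $f(0)=0$, $f'(0)=1$, $f'$ zero-free in $\mathbb D$, and $1+zf''(z)/f'(z)\in\Omega$ for all $z\in\mathbb D$. Write $a_2(f)=f''(0)/2$, and let $\log f'$ denote the analytic branch in $\mathbb D$ with $\log f'(0)=0$. Let $z_0\in\mathbb D\setminus\{0\}$ and $\lambda\in\mathbb C$ with $|\lambda|\le|\alpha_1|/2$, put $\gamma_1=2\lambda/\alpha_1$, and $$V(z_0,\lambda)=\{\log f'(z_0): f\in\mathcal{CV}(\Omega),\ a_2(f)=\lambda\}.$$ (i) If $|\lambda|=|\alpha_1|/2$, then $V(z_0,\lambda)$ consists of the single point $w_0=\int_0^{z_0}\zeta^{-1}\{P(\gamma_1\zeta)-1\}\,d\zeta$. (ii) If $|\lambda|<|\alpha_1|/2$, define, for $z\in\mathbb D$ and $\varepsilon\in\overline{\mathbb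 D}$ (and, for $z=z_0$, by the same formula for $\varepsilon$ in a neighbourhood of $\overline{\mathbb D}$), $$Q_{\gamma_1}(z,\varepsilon)=\int_0^{z}\zeta^{-1}\left\{P\left(\zeta\,\frac{\varepsilon\zeta+\gamma_1}{1+\overline{\gamma_1}\varepsilon\zeta}\right)-1\right\}d\zeta .$$ Then $V(z_0,\lambda)=Q_{\gamma_1}(z_0,\overline{\mathbb D}):=\{Q_{\gamma_1}(z_0,\varepsilon):\varepsilon\in\overline{\mathbb D}\}$, and $\varepsilon\mapsto Q_{\gamma_1}(z_0,\varepsilon)$ is a convex univalent analytic function on $\overline{\mathbb D}$: it is analytic in a neighbourhood of $\overline{\mathbb D}$, injective on $\overline{\mathbb D}$, and the images of $\mathbb D$ and of $\overline{\mathbb D}$ are convex. Furthermore, for every $\varepsilon$ with $|\varepsilon|=1$, a function $f$ on $\mathbb D$ satisfies $f\in\mathcal{CV}(\Omega)$, $a_2(f)=\lambda$ and $\log f'(z_0)=Q_{\gamma_1}(z_0,\varepsilon)$ if and only if $$f(z)=\int_0^z e^{Q_{\gamma_1}(\zeta,\varepsilon)}\,d\zeta\qquad(z\in\mathbb D).$$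 -/

import Mathlib

open Metric Set Complex

noncomputable section

namespace VarRegion

/-- `P` is a conformal map of the unit disk onto `Ω`. -/
structure IsConformalOnto (P : ℂ → ℂ) (Ω : Set ℂ) : Prop where
  differentiableOn : DifferentiableOn ℂ P (ball 0 1)
  injOn : InjOn P (ball 0 1)
  image_eq : P '' ball 0 1 = Ω

/-- The class `CV(Ω)`: analytic `f` in the unit disk with `f(0) = f'(0) - 1 = 0` such that
`1 + z f''(z) / f'(z)` is defined (so `f'` has no zeros) and lies in `Ω` for every `z`
in the unit disk. -/
structure IsCV (Ω : Set ℂ) (f : ℂ → ℂ) : Prop where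
  differentiableOn : DifferentiableOn ℂ f (ball 0 1)
  map_zero : f 0 = 0
  deriv_zero : deriv f 0 = 1
  deriv_ne_zero : ∀ z ∈ ball (0 : ℂ) 1, deriv f z ≠ 0
  mem : ∀ z ∈ ball (0 : ℂ) 1, 1 + z * (deriv (deriv f) z / deriv f z) ∈ Ω

/-- The Taylor coefficient `a_k(f) = f^{(k)}(0) / k!`. -/
def taylorCoeff (k : ℕ) (f : ℂ → ℂ) : ℂ := iteratedDeriv k f 0 / (k.factorial : ℂ)

/-- `L` is the single-valued analytic branch of `log f'` in the unit disk with
`log f'(0) = 0`. -/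
structure IsLogDeriv (f L : ℂ → ℂ) : Prop where
  differentiableOn : DifferentiableOn ℂ L (ball 0 1)
  map_zero : L 0 = 0
  exp_eq : ∀ z ∈ ball (0 : ℂ) 1, exp (L z) = deriv f z

/-- The variability region of `log f'(z₀)`, for `f` in `CV(Ω)` with `a₂(f) = lam`. -/
def variabilityRegion (Ω : Set ℂ) (z₀ lam : ℂ) : Set ℂ :=
  {w | ∃ f L : ℂ → ℂ, IsCV Ω f ∧ taylorCoeff 2 f = lam ∧ IsLogDeriv f L ∧ w = L z₀}

/-- The integral `∫₀ᶻ h(ζ) dζ` along the straight segment from `0` to `z`. -/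
def segInt (h : ℂ → ℂ) (z : ℂ) : ℂ := ∫ t in (0 : ℝ)..1, h ((t : ℂ) * z) * z

/-- The disk automorphism `σ_a(z) = (z + a) / (1 + conj a * z)`. -/
def sigma (a z : ℂ) : ℂ := (z + a) / (1 + (starRingEnd ℂ) a * z)

/-- `Q_γ(z, ε) = ∫₀ᶻ ζ⁻¹ {P(ζ σ_γ(ε ζ)) - 1} dζ`. -/
def Q (P : ℂ → ℂ) (γ z ε : ℂ) : ℂ :=
  segInt (fun ζ => ζ⁻¹ * (P (ζ * sigma γ (ε * ζ)) - 1)) z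

end VarRegion

end

noncomputable section

namespace VarRegion

open Filter Topology

/-! Write `L = log f'`. Since `1 + z L'` takes values in `Ω`, it equals `P (z s(z))` with `s`
analytic, `|s| ≤ 1` and `s 0 = γ`. If `|γ| = 1`, then `s` is constant and `f` is determined. If `|γ|
< 1`, the Schwarz lemma gives `s z = σ_γ (φ z * z)` with `φ` analytic and `|φ| ≤ 1`; every such `φ`
occurs, and `Q(·, ε)` is the case `φ = ε`.

Part (ii) rests on one inequality, `re_sub_Q_div_nonpos`: if `|φ| ≤ |ε| ≤ 1` and `ε ≠ 0`, then `(L -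
Q(·, ε)) / (ε ∂_ε Q(·, ε))` has nonpositive real part at every `z ≠ 0` of the disk, with equality
only for `φ = ε`. Constant `φ = b` shows that `q = Q(z₀, ·)` is injective and that its image lies in
all tangent half planes of the curve `q (e^{it})`. A point of all these half planes is covered by
`q` (`mem_image_closedBall_of_re_le`), so the image is their intersection and is convex. General `φ`
with `|ε| = 1` puts `L z₀` in the same intersection, and the equality case gives uniqueness on the
boundary.

The inequality is of Libera type. The functions `(L - Q) / ε` and `∂_ε Q` both have a double zero at
`0`; the quotient of their derivatives has nonpositive real part, and this passes to the quotient
itself because `∂_ε Q` is starlike (`re_div_nonpos_of_starlike`). Starlikeness comes from the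
convexity condition `Re (1 + z F'' / F') > 0` for `F = ∂_ε Q` (`re_div_pos_of_convex`).

Both pointwise inputs reduce to Möbius maps. For convex `P`, the ratio `(P a - P b) / P' a` agrees
with that of some `w / (1 - κ w)`, `|κ| ≤ 1`, and likewise `P'' / P'` at a point. This follows,
after moving the base point by an automorphism of the disk, from starlikeness of order one half
(Marx and Strohhäcker). -/

/-! ### Holomorphic inverses of conformal maps. -/

theorem IsConformalOnto.exists_inverse {K : ℂ → ℂ} {Ω : Set ℂ} (hK : IsConformalOnto K Ω) :
    ∃ S : ℂ → ℂ, DifferentiableOn ℂ S Ω ∧ MapsTo S Ω (ball 0 1) ∧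
      (∀ z ∈ ball (0 : ℂ) 1, S (K z) = z) ∧ ∀ w ∈ Ω, K (S w) = w := by
  set D : Set ℂ := ball 0 1
  have hDo : IsOpen D := isOpen_ball
  have hDc : IsPreconnected D := (convex_ball (0 : ℂ) 1).isPreconnected
  have hKa : AnalyticOnNhd ℂ K D := hK.differentiableOn.analyticOnNhd hDo
  have hnonconst : ¬ ∃ w, ∀ z ∈ D, K z = w := by
    rintro ⟨w, hw⟩
    have h0 : (0 : ℂ) ∈ D := by simp [D]
    have h1 : (1 / 2 : ℂ) ∈ D := by simp [D]; norm_num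
    have := hK.injOn h0 h1 (by rw [hw _ h0, hw _ h1])
    norm_num at this
  have hopen : ∀ s ⊆ D, IsOpen s → IsOpen (K '' s) :=
    (hKa.is_constant_or_isOpen hDc).resolve_left hnonconst
  set S := Function.invFunOn K D
  have hSD : MapsTo S Ω D := fun w hw => by
    rw [← hK.image_eq] at hw; exact Function.invFunOn_mem hw
  have hKS : ∀ w ∈ Ω, K (S w) = w := fun w hw => by
    rw [← hK.image_eq] at hw; exact Function.invFunOn_eq hw
  have hKD : ∀ z ∈ D, K z ∈ Ω := fun z hz => hK.image_eq ▸ mem_image_of_mem K hz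
  have hSK : ∀ z ∈ D, S (K z) = z := fun z hz =>
    hK.injOn (hSD (hKD z hz)) hz (hKS _ (hKD z hz))
  have hΩo : IsOpen Ω := hK.image_eq ▸ hopen D subset_rfl hDo
  have hScont : ∀ w ∈ Ω, ContinuousAt S w := by
    intro w hw
    rw [ContinuousAt, tendsto_def]
    intro s hs
    obtain ⟨t, hts, hto, hwt⟩ := _root_.mem_nhds_iff.1 hs
    have hmem : K '' (t ∩ D) ∈ 𝓝 w :=
      (hopen _ inter_subset_right (hto.inter hDo)).mem_nhds ⟨S w, ⟨hwt, hSD hw⟩, hKS w hw⟩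
    filter_upwards [hmem]
    rintro _ ⟨z, ⟨hzt, hzD⟩, rfl⟩
    simpa [hSK z hzD] using hts hzt
  have hdiff : ∀ w ∈ Ω, deriv K (S w) ≠ 0 → DifferentiableAt ℂ S w := by
    intro w hw hd
    have h1 : HasDerivAt K (deriv K (S w)) (S w) := (hKa _ (hSD hw)).differentiableAt.hasDerivAt
    exact (h1.of_local_left_inverse (hScont w hw) hd
      (by filter_upwards [hΩo.mem_nhds hw] with y hy using hKS y hy)).differentiableAt
  refine ⟨S, fun w hw => DifferentiableAt.differentiableWithinAt ?_, hSD, hSK, hKS⟩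
  -- Critical points of `K` are isolated, so `S` is differentiable in a punctured neighbourhood of
  -- `w` and continuous at `w`: the singularity is removable.
  have hev : ∀ᶠ z in 𝓝[≠] (S w), deriv K z ≠ 0 := by
    have hda : AnalyticAt ℂ (deriv K) (S w) := (hKa _ (hSD hw)).deriv
    rcases hda.eventually_eq_zero_or_eventually_ne_zero with h | h
    · exfalso
      have hz : EqOn (deriv K) 0 D :=
        (hKa.deriv).eqOn_zero_of_preconnected_of_eventuallyEq_zero hDc (hSD hw) h
      refine hnonconst ⟨K (S w), fun z hz' => ?_⟩
      exact (convex_ball (0 : ℂ) 1).is_const_of_fderivWithin_eq_zero (𝕜 := ℂ)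
        hK.differentiableOn (fun x hx => by
          rw [fderivWithin_of_isOpen hDo hx]
          ext
          simpa using hz hx) hz' (hSD hw)
    · exact h
  rw [eventually_nhdsWithin_iff] at hev
  have h2 : ∀ᶠ y in 𝓝 w, y ∈ Ω ∧ (S y ≠ S w → deriv K (S y) ≠ 0) :=
    (hΩo.eventually_mem hw).and ((hScont w hw).eventually hev)
  obtain ⟨r, hr, hball⟩ := Metric.eventually_nhds_iff_ball.1 h2
  have h3 := (Complex.differentiableOn_compl_singleton_and_continuousAt_iff (f := S)
    (ball_mem_nhds w hr)).1 ⟨fun y hy => by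
      have hy' := hball y hy.1
      refine (hdiff y hy'.1 (hy'.2 fun h => hy.2 ?_)).differentiableWithinAt
      rw [mem_singleton_iff, ← hKS y hy'.1, h, hKS w hw], hScont w hw⟩
  exact h3.differentiableAt (ball_mem_nhds w hr)

theorem IsConformalOnto.isOpen {K : ℂ → ℂ} {Ω : Set ℂ} (hK : IsConformalOnto K Ω) : IsOpen Ω := by
  have hKa : AnalyticOnNhd ℂ K (ball 0 1) := hK.differentiableOn.analyticOnNhd isOpen_ball
  rcases hKa.is_constant_or_isOpen (convex_ball (0 : ℂ) 1).isPreconnected with ⟨w, hw⟩ | h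
  · have h0 : (0 : ℂ) ∈ ball (0 : ℂ) 1 := by simp
    have h1 : (1 / 2 : ℂ) ∈ ball (0 : ℂ) 1 := by simp; norm_num
    have := hK.injOn h0 h1 (by rw [hw _ h0, hw _ h1])
    norm_num at this
  · exact hK.image_eq ▸ h _ subset_rfl isOpen_ball

theorem IsConformalOnto.hasDerivAt {K : ℂ → ℂ} {Ω : Set ℂ} (hK : IsConformalOnto K Ω) {z : ℂ}
    (hz : ‖z‖ < 1) : HasDerivAt K (deriv K z) z :=
  (hK.differentiableOn.differentiableAt
    (isOpen_ball.mem_nhds (mem_ball_zero_iff.2 hz))).hasDerivAt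

theorem IsConformalOnto.mem {K : ℂ → ℂ} {Ω : Set ℂ} (hK : IsConformalOnto K Ω) {z : ℂ}
    (hz : ‖z‖ < 1) : K z ∈ Ω :=
  hK.image_eq ▸ mem_image_of_mem K (mem_ball_zero_iff.2 hz)

theorem IsConformalOnto.deriv_ne_zero {K : ℂ → ℂ} {Ω : Set ℂ} (hK : IsConformalOnto K Ω) {z : ℂ}
    (hz : ‖z‖ < 1) : deriv K z ≠ 0 := by
  obtain ⟨S, hS, -, hSK, -⟩ := hK.exists_inverse
  have h1 := (hS.differentiableAt (hK.isOpen.mem_nhds (hK.mem hz))).hasDerivAt.comp z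
    (hK.hasDerivAt hz)
  have h2 : HasDerivAt (S ∘ K) 1 z := (hasDerivAt_id z).congr_of_eventuallyEq <| by
    filter_upwards [isOpen_ball.mem_nhds (mem_ball_zero_iff.2 hz)] with y hy using hSK y hy
  intro h
  have := h1.unique h2
  simp [h] at this

/-! ### Convex maps: supporting lines and starlikeness of order one half. -/

theorem nonpos_of_hasDerivAt_of_eventually_le {φ : ℝ → ℝ} {d : ℝ} (hφ : HasDerivAt φ d 0)
    (hle : ∀ᶠ t in 𝓝[>] (0 : ℝ), φ t ≤ φ 0) : d ≤ 0 := by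
  have h1 := (hasDerivWithinAt_iff_tendsto_slope' (s := Ioi (0 : ℝ)) (by simp)).1
    (hφ.hasDerivWithinAt)
  refine le_of_tendsto h1 ?_
  filter_upwards [hle, self_mem_nhdsWithin] with t ht (ht0 : 0 < t)
  rw [slope_def_field]
  exact div_nonpos_of_nonpos_of_nonneg (by linarith) (by simpa using ht0.le)

/-- Images of concentric disks under a convex conformal map have a supporting line at every
boundary point. -/
theorem IsConformalOnto.re_sub_mul_conj_nonneg {K : ℂ → ℂ} {Ω : Set ℂ}
    (hK : IsConformalOnto K Ω) (hΩ : Convex ℝ Ω) {a b : ℂ} (ha : ‖a‖ < 1) (hba : ‖b‖ ≤ ‖a‖) :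
    0 ≤ ((K a - K b) * (starRingEnd ℂ) (a * deriv K a)).re := by
  rcases eq_or_ne a 0 with rfl | ha0
  · simp
  obtain ⟨S, hS, hSD, hSK, hKS⟩ := hK.exists_inverse
  have hna : 0 < ‖a‖ := norm_pos_iff.2 ha0
  -- The map `z ↦ S ((1 - t) K (a z) + t K (b z))` sends the disk of radius `1 / ‖a‖` into the unit
  -- disk and fixes `0`. The Schwarz lemma at `z = 1` gives the bound.
  have key : ∀ t : ℝ, 0 ≤ t → t ≤ 1 → ‖S ((1 - t) * K a + t * K b)‖ ≤ ‖a‖ := by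
    intro t ht0 ht1
    have hball : ∀ z ∈ ball (0 : ℂ) (1 / ‖a‖), ‖a * z‖ < 1 ∧ ‖b * z‖ < 1 := by
      intro z hz
      rw [mem_ball_zero_iff, lt_div_iff₀ hna] at hz
      constructor
      · rw [norm_mul]; linarith [mul_comm ‖a‖ ‖z‖]
      · rw [norm_mul]
        have := mul_le_mul_of_nonneg_right hba (norm_nonneg z)
        linarith [mul_comm ‖a‖ ‖z‖]
    have hmem : ∀ z ∈ ball (0 : ℂ) (1 / ‖a‖), (1 - t) * K (a * z) + t * K (b * z) ∈ Ω := by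
      intro z hz
      have := hΩ (hK.mem (hball z hz).1) (hK.mem (hball z hz).2) (sub_nonneg.2 ht1) ht0 (by ring)
      simpa using this
    have hd : DifferentiableOn ℂ (fun z => S ((1 - t) * K (a * z) + t * K (b * z)))
        (ball 0 (1 / ‖a‖)) := by
      intro z hz
      have e1 := (hK.hasDerivAt (hball z hz).1).differentiableAt
      have e2 := (hK.hasDerivAt (hball z hz).2).differentiableAt
      have e3 := hS.differentiableAt (hK.isOpen.mem_nhds (hmem z hz))
      have e4 : DifferentiableAt ℂ (fun z => K (a * z)) z :=
        e1.comp z (by fun_prop : DifferentiableAt ℂ (fun z => a * z) z)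
      have e5 : DifferentiableAt ℂ (fun z => K (b * z)) z :=
        e2.comp z (by fun_prop : DifferentiableAt ℂ (fun z => b * z) z)
      exact (e3.comp z (f := fun z => (1 - t) * K (a * z) + t * K (b * z))
        (by fun_prop)).differentiableWithinAt
    have h0 : S ((1 - t) * K (a * 0) + t * K (b * 0)) = 0 := by
      have : (1 - t) * K (a * 0) + t * K (b * 0) = K 0 := by simp only [mul_zero]; ring
      rw [this, hSK 0 (by simp)]
    have hm : MapsTo (fun z => S ((1 - t) * K (a * z) + t * K (b * z))) (ball 0 (1 / ‖a‖))
        (closedBall (S ((1 - t) * K (a * 0) + t * K (b * 0))) 1) := by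
      intro z hz
      rw [h0]
      exact ball_subset_closedBall (hSD (hmem z hz))
    have := dist_le_div_mul_dist_of_mapsTo_ball (z := 1) hd hm
      (by rw [mem_ball_zero_iff, lt_div_iff₀ hna]; simpa using ha)
    simp only [h0] at this
    simpa using this
  have hd1 : HasDerivAt S (deriv K a)⁻¹ (K a) := by
    have h := hK.hasDerivAt ha
    have hSa : S (K a) = a := hSK a (mem_ball_zero_iff.2 ha)
    refine HasDerivAt.of_local_left_inverse (f := K) (g := S)
      (hS.differentiableAt (hK.isOpen.mem_nhds (hK.mem ha))).continuousAt (by rw [hSa]; exact h)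
      (hK.deriv_ne_zero ha) ?_
    filter_upwards [hK.isOpen.mem_nhds (hK.mem ha)] with y hy using hKS y hy
  -- This curve starts at `a` and stays in the disk of radius `‖a‖`, so its squared norm has
  -- nonpositive derivative at `t = 0`. Up to a positive factor, that is the claim.
  have hd2 : HasDerivAt (fun t : ℝ => S ((1 - t) * K a + t * K b))
      ((deriv K a)⁻¹ * (K b - K a)) 0 := by
    have e1 : HasDerivAt (fun t : ℂ => (1 - t) * K a + t * K b) (K b - K a) ((0 : ℝ) : ℂ) := by
      have := (((hasDerivAt_id ((0 : ℝ) : ℂ)).const_sub 1).mul_const (K a)).add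
        ((hasDerivAt_id ((0 : ℝ) : ℂ)).mul_const (K b))
      convert! this using 1; ring
    have e2 := HasDerivAt.comp (h₂ := S) ((0 : ℝ) : ℂ)
      (by simpa using hd1) e1
    exact e2.comp_ofReal
  have hd3 := hd2.norm_sq
  have := nonpos_of_hasDerivAt_of_eventually_le hd3 (by
    filter_upwards [Ioo_mem_nhdsGT (zero_lt_one (α := ℝ))] with t ht
    have h1 := key t ht.1.le ht.2.le
    have h2 : S ((1 - (0 : ℝ)) * K a + (0 : ℝ) * K b) = a := by
      simpa using hSK a (mem_ball_zero_iff.2 ha)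
    simp only [h2]
    exact pow_le_pow_left₀ (norm_nonneg _) h1 2)
  have h2 : S ((1 - ((0 : ℝ) : ℂ)) * K a + ((0 : ℝ) : ℂ) * K b) = a := by
    simpa using hSK a (mem_ball_zero_iff.2 ha)
  rw [h2, Complex.inner] at this
  have hne := hK.deriv_ne_zero ha
  have h3 : (K a - K b) * (starRingEnd ℂ) (a * deriv K a) =
      -((normSq (deriv K a) : ℝ) : ℂ) * ((deriv K a)⁻¹ * (K b - K a) * (starRingEnd ℂ) a) := by
    rw [map_mul, ← Complex.mul_conj]
    field_simp
    ring
  rw [h3, ← ofReal_neg, re_ofReal_mul]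
  nlinarith [normSq_nonneg (deriv K a)]

theorem re_div_nonneg {x y : ℂ} (h : 0 ≤ (y * (starRingEnd ℂ) x).re) : 0 ≤ (x / y).re := by
  rw [div_re, ← add_div]
  refine div_nonneg ?_ (normSq_nonneg y)
  simp at h
  linarith

theorem IsConformalOnto.dslope_ne_zero {K : ℂ → ℂ} {Ω : Set ℂ} (hK : IsConformalOnto K Ω)
    {a w : ℂ} (ha : ‖a‖ < 1) (hw : ‖w‖ < 1) : dslope K a w ≠ 0 := by
  rcases eq_or_ne w a with rfl | h
  · rw [dslope_same]; exact hK.deriv_ne_zero ha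
  · rw [dslope_of_ne _ h, slope_def_field]
    exact div_ne_zero (sub_ne_zero.2 fun he => h <|
      hK.injOn (mem_ball_zero_iff.2 hw) (mem_ball_zero_iff.2 ha) he) (sub_ne_zero.2 h)

/-- Convex conformal maps of the disk are starlike of order one half. -/
theorem IsConformalOnto.one_le_re_two_mul_div {K : ℂ → ℂ} {Ω : Set ℂ}
    (hK : IsConformalOnto K Ω) (hΩ : Convex ℝ Ω) {a : ℂ} (ha : ‖a‖ < 1) (ha0 : a ≠ 0) :
    1 ≤ (2 * a * deriv K a / (K a - K 0)).re := by
  -- `N` is chosen so that `-dslope N a w` extends `2 a K' a / (K a - K w) - (a + w) / (a - w)`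
  -- across `w = a`, where the poles cancel. The value at `w = 0` is the quantity wanted minus `1`,
  -- and on `|w| = |a|` the second fraction is purely imaginary while the first is controlled by the
  -- supporting line.
  set N : ℂ → ℂ := fun w => 2 * a * deriv K a / dslope K a w - (a + w) with hN
  have hD : ball (0 : ℂ) 1 ∈ 𝓝 a := isOpen_ball.mem_nhds (mem_ball_zero_iff.2 ha)
  have hdK : DifferentiableOn ℂ (dslope K a) (ball 0 1) :=
    (differentiableOn_dslope hD).2 hK.differentiableOn
  have hdN : DifferentiableOn ℂ N (ball 0 1) := by
    refine DifferentiableOn.sub (DifferentiableOn.div (by fun_prop) hdK ?_) (by fun_prop)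
    intro w hw
    exact hK.dslope_ne_zero ha (mem_ball_zero_iff.1 hw)
  have hdW : DifferentiableOn ℂ (dslope N a) (ball 0 1) := (differentiableOn_dslope hD).2 hdN
  have hNa : N a = 0 := by
    have := hK.deriv_ne_zero ha
    simp only [hN, dslope_same]
    field_simp
    ring
  have hW : ∀ w : ℂ, ‖w‖ < 1 → w ≠ a →
      -dslope N a w = 2 * a * deriv K a / (K a - K w) - (a + w) / (a - w) := by
    intro w hw hwa
    have h1 : w - a ≠ 0 := sub_ne_zero.2 hwa
    have h1' : a - w ≠ 0 := sub_ne_zero.2 hwa.symm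
    have h2 : K w - K a ≠ 0 := sub_ne_zero.2 fun he => hwa <|
      hK.injOn (mem_ball_zero_iff.2 hw) (mem_ball_zero_iff.2 ha) he
    have h2' : K a - K w ≠ 0 := by rw [← neg_sub]; exact neg_ne_zero.2 h2
    rw [dslope_of_ne _ hwa, slope_def_field, hNa, sub_zero]
    simp only [hN]
    rw [dslope_of_ne _ hwa, slope_def_field, ← neg_sub (K w), ← neg_sub w a]
    field_simp
    ring
  have hcirc : ∀ w : ℂ, ‖w‖ = ‖a‖ → w ≠ a → 0 ≤ (-dslope N a w).re := by
    intro w hw hwa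
    rw [hW w (hw ▸ ha) hwa, sub_re]
    have h1 : ((a + w) / (a - w)).re = 0 := by
      have h3 : w.re * w.re + w.im * w.im = a.re * a.re + a.im * a.im := by
        rw [← normSq_apply, ← normSq_apply, ← Complex.sq_norm, ← Complex.sq_norm, hw]
      rw [div_re, ← add_div]
      simp only [add_re, sub_re, add_im, sub_im]
      rw [div_eq_zero_iff]
      left
      linarith
    have h2 := hK.re_sub_mul_conj_nonneg hΩ ha hw.le
    rw [h1, sub_zero, mul_assoc, mul_div_assoc]
    have h3 := re_div_nonneg h2
    simpa using h3
  -- The point `w = a` is reached by continuity along the circle.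
  have hcirc' : ∀ w : ℂ, ‖w‖ = ‖a‖ → 0 ≤ (-dslope N a w).re := by
    intro w hw
    rcases eq_or_ne w a with rfl | hwa
    · have hc : ContinuousAt (fun t : ℝ => (-dslope N w (w * exp (t * I))).re) 0 := by
        have h1 : ContinuousAt (dslope N w) (w * exp ((0 : ℝ) * I)) := by
          simpa using (hdW.differentiableAt hD).continuousAt
        exact continuous_re.continuousAt.comp
          (ContinuousAt.neg (ContinuousAt.comp (g := dslope N w)
            (f := fun t : ℝ => w * exp (t * I)) h1 (by fun_prop)))
      have h2 := hc.tendsto.mono_left (nhdsWithin_le_nhds (s := Ioi (0 : ℝ)))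
      simp only [ofReal_zero, zero_mul, exp_zero, mul_one] at h2
      refine ge_of_tendsto h2 ?_
      filter_upwards [Ioo_mem_nhdsGT Real.pi_pos] with t ht
      refine hcirc _ (by rw [norm_mul, norm_exp_ofReal_mul_I, mul_one]) fun h => ?_
      have h3 : exp (t * I) = 1 := mul_left_cancel₀ ha0 (by rw [h, mul_one])
      have h4 := congrArg Complex.im h3
      rw [exp_ofReal_mul_I_im] at h4
      exact (Real.sin_pos_of_pos_of_lt_pi ht.1 ht.2).ne' (by simpa using h4)
    · exact hcirc w hw hwa
  have hna : 0 < ‖a‖ := norm_pos_iff.2 ha0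
  have hsub : closedBall (0 : ℂ) ‖a‖ ⊆ ball 0 1 := closedBall_subset_ball ha
  -- Exponentiating turns the maximum principle for real parts into the maximum modulus principle.
  have hmax := Complex.norm_le_of_forall_mem_frontier_norm_le (f := fun w => exp (dslope N a w))
    (U := ball (0 : ℂ) ‖a‖) (C := 1) isBounded_ball
    (DifferentiableOn.diffContOnCl (by
      rw [closure_ball _ hna.ne']
      exact (hdW.mono hsub).cexp))
    (fun w hw => by
      rw [frontier_ball _ hna.ne', mem_sphere_zero_iff_norm] at hw
      have := hcirc' w hw
      rw [neg_re] at this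
      simp only [norm_exp]
      exact Real.exp_le_one_iff.2 (by linarith))
    (z := 0) (subset_closure (mem_ball_self hna))
  simp only [norm_exp] at hmax
  have h5 := Real.exp_le_one_iff.1 hmax
  have h6 := congrArg Complex.re (hW 0 (by simp) ha0.symm)
  simp [div_self ha0] at h6
  linarith

/-- For a convex conformal map, `(K a - K 0) / (a K' a)` lies in the disk of radius `‖a‖`
around `1`, and `‖K'' 0‖ ≤ 2 ‖K' 0‖`. -/
theorem IsConformalOnto.norm_sub_sub_le {K : ℂ → ℂ} {Ω : Set ℂ}
    (hK : IsConformalOnto K Ω) (hΩ : Convex ℝ Ω) :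
    (∀ a : ℂ, ‖a‖ < 1 → ‖K a - K 0 - a * deriv K a‖ ≤ ‖a‖ ^ 2 * ‖deriv K a‖) ∧
      ‖deriv (deriv K) 0‖ ≤ 2 * ‖deriv K 0‖ := by
  have hD : ball (0 : ℂ) 1 ∈ 𝓝 (0 : ℂ) := isOpen_ball.mem_nhds (by simp)
  have hdK : DifferentiableOn ℂ (dslope K 0) (ball 0 1) :=
    (differentiableOn_dslope hD).2 hK.differentiableOn
  have hdK' : DifferentiableOn ℂ (deriv K) (ball 0 1) := hK.differentiableOn.deriv isOpen_ball
  have h00 := hK.deriv_ne_zero (z := 0) (by simp)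
  -- With `V = a K' a / (K a - K 0)`, `u = 1 / V - 1`, and `Re V ≥ 1/2` means exactly `|u| ≤ 1`.
  -- Since `u 0 = 0`, the Schwarz lemma bounds both `|u a|` and `|u' 0|`, which give the two claims.
  set u : ℂ → ℂ := fun a => dslope K 0 a / deriv K a - 1 with hu
  have hdu : DifferentiableOn ℂ u (ball 0 1) :=
    (hdK.div hdK' fun a ha => hK.deriv_ne_zero (mem_ball_zero_iff.1 ha)).sub_const 1
  have hu0 : u 0 = 0 := by simp [hu, h00]
  have hmaps : MapsTo u (ball 0 1) (closedBall (u 0) 1) := by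
    intro a ha
    rw [hu0, mem_closedBall_zero_iff]
    rw [mem_ball_zero_iff] at ha
    rcases eq_or_ne a 0 with rfl | ha0
    · simp [hu0]
    have h1 := hK.one_le_re_two_mul_div hΩ ha ha0
    have h2 := hK.dslope_ne_zero (a := 0) (by simp) ha
    have h3 := hK.deriv_ne_zero ha
    have h4 : dslope K 0 a = (K a - K 0) / a := by
      rw [dslope_of_ne _ ha0, slope_def_field, sub_zero]
    set V := deriv K a / dslope K 0 a with hV
    have hV0 : V ≠ 0 := div_ne_zero h3 h2
    have h5 : 1 ≤ 2 * V.re := by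
      have : 2 * a * deriv K a / (K a - K 0) = 2 * V := by
        rw [hV, h4]; rw [h4] at h2
        have := (div_ne_zero_iff.1 h2).1
        field_simp
      rw [this] at h1
      simpa using h1
    have h6 : u a = (1 - V) / V := by
      simp only [hu, hV]; field_simp
    rw [h6, norm_div, div_le_one (norm_pos_iff.2 hV0)]
    refine (sq_le_sq₀ (norm_nonneg _) (norm_nonneg _)).1 ?_
    rw [Complex.sq_norm, Complex.sq_norm, normSq_apply, normSq_apply]
    simp
    nlinarith
  refine ⟨fun a ha => ?_, ?_⟩
  · have h3 := hK.deriv_ne_zero ha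
    have h1 := dist_le_div_mul_dist_of_mapsTo_ball hdu hmaps (mem_ball_zero_iff.2 ha)
    rw [hu0] at h1
    simp only [dist_zero_right, div_one, one_mul] at h1
    have h2 : K a - K 0 = a * dslope K 0 a := by
      simpa using (sub_smul_dslope K 0 a).symm
    have h4 : K a - K 0 - a * deriv K a = a * u a * deriv K a := by
      rw [h2]; simp only [hu]; field_simp
    rw [h4, norm_mul, norm_mul]
    have := mul_le_mul_of_nonneg_left h1 (norm_nonneg a)
    nlinarith [mul_le_mul_of_nonneg_right this (norm_nonneg (deriv K a))]
  · have h1 := norm_deriv_le_one_of_mapsTo_ball hdu hmaps one_pos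
    have e1 : HasDerivAt (dslope K 0) (deriv (dslope K 0) 0) 0 :=
      (hdK.differentiableAt hD).hasDerivAt
    have e2 : HasDerivAt (deriv K) (deriv (deriv K) 0) 0 := (hdK'.differentiableAt hD).hasDerivAt
    have e3 : deriv K =ᶠ[𝓝 0] fun z => dslope K 0 z + z * deriv (dslope K 0) z := by
      filter_upwards [hD] with z hz
      have e4 : HasDerivAt (dslope K 0) (deriv (dslope K 0) z) z :=
        (hdK.differentiableAt (isOpen_ball.mem_nhds hz)).hasDerivAt
      have e5 : K = fun z => z * dslope K 0 z + K 0 := by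
        funext z
        have := sub_smul_dslope K 0 z
        simp only [sub_zero, smul_eq_mul] at this
        rw [this]; ring
      have e6 := (((hasDerivAt_id z).mul e4).add_const (K 0)).deriv
      have e7 : deriv K z = deriv (fun z => z * dslope K 0 z + K 0) z := by
        exact congrArg (fun f => deriv f z) e5
      rw [e7]
      refine Eq.trans e6 ?_
      simp
    have e4 : HasDerivAt (deriv (dslope K 0)) (deriv (deriv (dslope K 0)) 0) 0 :=
      ((hdK.deriv isOpen_ball).differentiableAt hD).hasDerivAt
    have e5 : deriv (deriv K) 0 = 2 * deriv (dslope K 0) 0 := by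
      rw [e3.deriv_eq]
      have := (e1.add ((hasDerivAt_id (0 : ℂ)).mul e4)).deriv
      refine Eq.trans this ?_
      simp; ring
    have e6 : deriv u 0 = -(deriv (deriv K) 0) / (2 * deriv K 0) := by
      refine ((e1.div e2 h00).sub_const 1).deriv.trans ?_
      rw [e5, dslope_same]
      field_simp
      ring
    rw [e6, norm_div, norm_neg, div_le_one (by simpa using h00)] at h1
    simpa using h1

/-! ### Automorphisms of the disk. -/

theorem one_add_conj_mul_ne_zero {a z : ℂ} (ha : ‖a‖ < 1) (hz : ‖z‖ ≤ 1) :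
    1 + (starRingEnd ℂ) a * z ≠ 0 := by
  intro h
  have h1 : ‖(starRingEnd ℂ) a * z‖ = 1 := by
    rw [← neg_eq_iff_add_eq_zero.2 h]; simp
  rw [norm_mul, RCLike.norm_conj] at h1
  nlinarith [norm_nonneg a, norm_nonneg z]

theorem normSq_one_add_sub {a z : ℂ} :
    normSq (1 + (starRingEnd ℂ) a * z) - normSq (z + a) = (1 - normSq a) * (1 - normSq z) := by
  simp [normSq_apply]
  ring

theorem norm_sigma_lt_one {a z : ℂ} (ha : ‖a‖ < 1) (hz : ‖z‖ < 1) : ‖sigma a z‖ < 1 := by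
  have h := one_add_conj_mul_ne_zero ha hz.le
  rw [sigma, norm_div, div_lt_one (norm_pos_iff.2 h)]
  refine (sq_lt_sq₀ (norm_nonneg _) (norm_nonneg _)).1 ?_
  have := normSq_one_add_sub (a := a) (z := z)
  rw [← Complex.sq_norm, ← Complex.sq_norm, ← Complex.sq_norm, ← Complex.sq_norm] at this
  have h1 : 0 < 1 - ‖a‖ ^ 2 := by nlinarith [norm_nonneg a]
  have h2 : 0 < 1 - ‖z‖ ^ 2 := by nlinarith [norm_nonneg z]
  nlinarith [mul_pos h1 h2]

theorem hasDerivAt_sigma {a z : ℂ} (h : 1 + (starRingEnd ℂ) a * z ≠ 0) :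
    HasDerivAt (sigma a) ((1 - normSq a) / (1 + (starRingEnd ℂ) a * z) ^ 2) z := by
  have h1 : HasDerivAt (fun z => 1 + (starRingEnd ℂ) a * z) ((starRingEnd ℂ) a) z := by
    simpa using ((hasDerivAt_id z).const_mul ((starRingEnd ℂ) a)).const_add 1
  have := ((hasDerivAt_id z).add_const a).div h1 h
  convert! this using 1
  rw [← mul_conj]
  simp; ring

theorem one_sub_normSq_ne_zero {a : ℂ} (ha : ‖a‖ < 1) : (1 - (normSq a : ℂ)) ≠ 0 := by
  rw [← ofReal_one, ← ofReal_sub, ofReal_ne_zero, ← Complex.sq_norm]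
  nlinarith [norm_nonneg a]

theorem sigma_neg_sigma {a z : ℂ} (ha : ‖a‖ < 1) (hz : ‖z‖ < 1) : sigma (-a) (sigma a z) = z := by
  have h1 := one_add_conj_mul_ne_zero ha hz.le
  have h2 := one_add_conj_mul_ne_zero (a := -a) (by simpa using ha) (norm_sigma_lt_one ha hz).le
  have h3 : sigma a z * (1 + (starRingEnd ℂ) a * z) = z + a := div_mul_cancel₀ _ h1
  rw [sigma, div_eq_iff h2, map_neg]
  refine mul_right_cancel₀ h1 ?_
  linear_combination (1 + (starRingEnd ℂ) a * z) * h3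

theorem IsConformalOnto.comp_sigma {P : ℂ → ℂ} {Ω : Set ℂ} (hP : IsConformalOnto P Ω) {c : ℂ}
    (hc : ‖c‖ < 1) : IsConformalOnto (fun z => P (sigma c z)) Ω where
  differentiableOn := by
    intro z hz
    rw [mem_ball_zero_iff] at hz
    exact ((hP.hasDerivAt (norm_sigma_lt_one hc hz)).comp z (hasDerivAt_sigma
      (one_add_conj_mul_ne_zero hc hz.le))).differentiableAt.differentiableWithinAt
  injOn := by
    intro z hz w hw h
    rw [mem_ball_zero_iff] at hz hw
    have h1 := hP.injOn (mem_ball_zero_iff.2 (norm_sigma_lt_one hc hz))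
      (mem_ball_zero_iff.2 (norm_sigma_lt_one hc hw)) h
    rw [← sigma_neg_sigma hc hz, h1, sigma_neg_sigma hc hw]
  image_eq := by
    ext w
    constructor
    · rintro ⟨z, hz, rfl⟩
      exact hP.mem (norm_sigma_lt_one hc (mem_ball_zero_iff.1 hz))
    · intro hw
      rw [← hP.image_eq] at hw
      obtain ⟨z, hz, rfl⟩ := hw
      rw [mem_ball_zero_iff] at hz
      have hc' : ‖-c‖ < 1 := by simpa using hc
      refine ⟨sigma (-c) z, mem_ball_zero_iff.2 (norm_sigma_lt_one hc' hz), ?_⟩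
      have := sigma_neg_sigma hc' hz
      rw [neg_neg] at this
      simp only [this]

/-! ### Comparison of convex maps with Möbius maps. -/

theorem ofReal_normSq_sub_pos {c : ℂ} (hc : ‖c‖ < 1) : 0 < 1 - normSq c := by
  rw [← Complex.sq_norm]
  nlinarith [norm_nonneg c]

/-- The relation is an identity for `P w = w / (1 - κ w)`, so two-point estimates for convex maps
become Möbius computations. It comes from applying the bound at base point `0` to `P ∘ σ_b`. -/
theorem IsConformalOnto.exists_sub_mul_eq {P : ℂ → ℂ} {Ω : Set ℂ} (hP : IsConformalOnto P Ω)
    (hΩ : Convex ℝ Ω) {a b : ℂ} (ha : ‖a‖ < 1) (hb : ‖b‖ < 1) :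
    ∃ κ : ℂ, ‖κ‖ ≤ 1 ∧ (P a - P b) * (1 - κ * b) = (a - b) * deriv P a * (1 - κ * a) := by
  rcases eq_or_ne a b with rfl | hab
  · exact ⟨0, by simp, by simp⟩
  have hb' : ‖-b‖ < 1 := by simpa using hb
  have hc0 := one_sub_normSq_ne_zero hb
  have hcpos := ofReal_normSq_sub_pos hb
  set a' := sigma (-b) a with ha'
  have hna' : ‖a'‖ < 1 := norm_sigma_lt_one hb' ha
  have hinv : sigma b a' = a := by simpa using sigma_neg_sigma hb' ha
  have hq := one_add_conj_mul_ne_zero hb' ha.le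
  have hq' := one_add_conj_mul_ne_zero hb hna'.le
  have hd : deriv (fun z => P (sigma b z)) a' =
      deriv P a * ((1 - normSq b) / (1 + (starRingEnd ℂ) b * a') ^ 2) := by
    have h1 := hP.hasDerivAt (z := sigma b a') (hinv ▸ ha)
    have h2 := (h1.comp a' (hasDerivAt_sigma hq')).deriv
    rw [hinv] at h2
    exact h2
  have hmain := ((hP.comp_sigma hb).norm_sub_sub_le hΩ).1 a' hna'
  have hs0 : sigma b 0 = b := by simp [sigma]
  rw [hd] at hmain
  simp only [hinv, hs0] at hmain
  rw [map_neg] at hq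
  have hq1 : 1 - (starRingEnd ℂ) b * a ≠ 0 := by rw [sub_eq_add_neg, ← neg_mul]; exact hq
  have hqe : 1 + (starRingEnd ℂ) b * a' = (1 - normSq b) / (1 - (starRingEnd ℂ) b * a) := by
    rw [ha', sigma, map_neg, neg_mul, ← sub_eq_add_neg, ← sub_eq_add_neg, ← mul_conj]
    field_simp
    ring
  have ha'e : a' = (a - b) / (1 - (starRingEnd ℂ) b * a) := by
    rw [ha', sigma, map_neg, neg_mul, ← sub_eq_add_neg, ← sub_eq_add_neg]
  have hPa := hP.deriv_ne_zero ha
  have hab' : a - b ≠ 0 := sub_ne_zero.2 hab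
  set X := (P a - P b) / ((a - b) * deriv P a) with hX
  have hPX : P a - P b = X * ((a - b) * deriv P a) := by rw [hX]; field_simp
  have e1 : P a - P b - a' * (deriv P a * ((1 - normSq b) / (1 + (starRingEnd ℂ) b * a') ^ 2)) =
      ((1 - normSq b) * X - (1 - (starRingEnd ℂ) b * a)) *
        ((a - b) * deriv P a / (1 - normSq b)) := by
    rw [hqe, ha'e, hPX]
    field_simp
  have e2 : ‖a'‖ ^ 2 * ‖deriv P a * ((1 - normSq b) / (1 + (starRingEnd ℂ) b * a') ^ 2)‖ =
      ‖a - b‖ * ‖(a - b) * deriv P a / (1 - normSq b)‖ := by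
    rw [← norm_pow, ← norm_mul, ← norm_mul, hqe, ha'e]
    have : ((a - b) / (1 - (starRingEnd ℂ) b * a)) ^ 2 * (deriv P a * ((1 - normSq b) /
        ((1 - normSq b) / (1 - (starRingEnd ℂ) b * a)) ^ 2)) =
        (a - b) * ((a - b) * deriv P a / (1 - normSq b)) := by
      generalize 1 - (starRingEnd ℂ) b * a = t at hq1 ⊢
      field_simp
    rw [this]
  rw [e1, e2, norm_mul] at hmain
  have h3 := le_of_mul_le_mul_right hmain
    (norm_pos_iff.2 (div_ne_zero (mul_ne_zero hab' hPa) hc0))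
  -- This identity turns the disk condition on `X` into `|X - 1| ≤ |X b - a|`, which is `|κ| ≤ 1`
  -- for the `κ` solving the equation.
  have h4 : normSq (a - b) - normSq ((1 - normSq b) * X - (1 - (starRingEnd ℂ) b * a)) =
      (1 - normSq b) * (normSq (X * b - a) - normSq (X - 1)) := by
    simp [normSq_apply]
    ring
  have h5 := (sq_le_sq₀ (norm_nonneg _) (norm_nonneg _)).2 h3
  rw [Complex.sq_norm, Complex.sq_norm] at h5
  have h6 : normSq (X - 1) ≤ normSq (X * b - a) := by
    by_contra h
    push Not at h
    nlinarith [mul_pos hcpos (sub_pos.2 h)]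
  have h7 : X * b - a ≠ 0 := by
    intro h
    rw [h, map_zero] at h6
    have h8 := normSq_eq_zero.1 (le_antisymm h6 (normSq_nonneg _))
    rw [sub_eq_zero.1 h8, one_mul] at h
    exact hab' (by rw [← neg_sub, h, neg_zero])
  refine ⟨(X - 1) / (X * b - a), ?_, ?_⟩
  · rw [norm_div, div_le_one (norm_pos_iff.2 h7)]
    refine (sq_le_sq₀ (norm_nonneg _) (norm_nonneg _)).1 ?_
    rwa [Complex.sq_norm, Complex.sq_norm]
  · rw [hPX]
    have : X * (1 - (X - 1) / (X * b - a) * b) = 1 - (X - 1) / (X * b - a) * a := by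
      field_simp
      ring
    linear_combination ((a - b) * deriv P a) * this

/-- The infinitesimal version: for `w / (1 - k w)` the ratio `P'' / P'` at `c` is `2 k / (1 - k c)`.
The bound on `k` is the second-coefficient bound for `P ∘ σ_c`. -/
theorem IsConformalOnto.exists_deriv_deriv_mul_eq {P : ℂ → ℂ} {Ω : Set ℂ}
    (hP : IsConformalOnto P Ω) (hΩ : Convex ℝ Ω) {c : ℂ} (hc : ‖c‖ < 1) :
    ∃ k : ℂ, ‖k‖ ≤ 1 ∧ deriv (deriv P) c * (1 - k * c) = 2 * k * deriv P c := by
  have hc0 := one_sub_normSq_ne_zero hc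
  have hcpos := ofReal_normSq_sub_pos hc
  have hs0 : sigma c 0 = c := by simp [sigma]
  have hPc := hP.deriv_ne_zero hc
  have hmain := ((hP.comp_sigma hc).norm_sub_sub_le hΩ).2
  have hd : ∀ z : ℂ, ‖z‖ < 1 → deriv (fun z => P (sigma c z)) z =
      deriv P (sigma c z) * ((1 - normSq c) / (1 + (starRingEnd ℂ) c * z) ^ 2) := fun z hz =>
    ((hP.hasDerivAt (norm_sigma_lt_one hc hz)).comp z (hasDerivAt_sigma
      (one_add_conj_mul_ne_zero hc hz.le))).deriv
  have hdd : deriv (deriv (fun z => P (sigma c z))) 0 =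
      (1 - normSq c) * (deriv (deriv P) c * (1 - normSq c) -
        2 * (starRingEnd ℂ) c * deriv P c) := by
    have h1 : deriv (fun z => P (sigma c z)) =ᶠ[𝓝 0] fun z =>
        deriv P (sigma c z) * ((1 - normSq c) / (1 + (starRingEnd ℂ) c * z) ^ 2) := by
      filter_upwards [isOpen_ball.mem_nhds (mem_ball_self one_pos)] with z hz using
        hd z (mem_ball_zero_iff.1 hz)
    rw [h1.deriv_eq]
    have h2 : HasDerivAt (deriv P) (deriv (deriv P) c) (sigma c 0) := by
      rw [hs0]
      exact ((hP.differentiableOn.deriv isOpen_ball).differentiableAt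
        (isOpen_ball.mem_nhds (mem_ball_zero_iff.2 hc))).hasDerivAt
    have h3 := h2.comp 0 (hasDerivAt_sigma (a := c) (z := 0) (by simp))
    have h4 : HasDerivAt (fun z => (1 + (starRingEnd ℂ) c * z)) ((starRingEnd ℂ) c) 0 := by
      simpa using ((hasDerivAt_id (0 : ℂ)).const_mul ((starRingEnd ℂ) c)).const_add 1
    have h5 := ((hasDerivAt_const (0 : ℂ) (1 - (normSq c : ℂ))).div (h4.pow 2) (by simp))
    refine (h3.mul h5).deriv.trans ?_
    simp [hs0]
    ring
  rw [hdd, hd 0 (by simp), hs0] at hmain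
  simp only [mul_zero, add_zero, one_pow, div_one] at hmain
  rw [norm_mul, norm_mul, mul_comm, ← mul_assoc] at hmain
  have h1 := le_of_mul_le_mul_right hmain (norm_pos_iff.2 hc0)
  set Y := deriv (deriv P) c / deriv P c with hY
  have hPY : deriv (deriv P) c = Y * deriv P c := by rw [hY]; field_simp
  have e1 : deriv (deriv P) c * (1 - normSq c) - 2 * (starRingEnd ℂ) c * deriv P c =
      (Y * (1 - normSq c) - 2 * (starRingEnd ℂ) c) * deriv P c := by
    rw [hPY]; ring
  rw [e1, norm_mul] at h1
  have h2 := le_of_mul_le_mul_right h1 (norm_pos_iff.2 hPc)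
  have h3 : 4 - normSq (Y * (1 - normSq c) - 2 * (starRingEnd ℂ) c) =
      (1 - normSq c) * (normSq (2 + c * Y) - normSq Y) := by
    simp [normSq_apply]
    ring
  have h5 := (sq_le_sq₀ (norm_nonneg _) (by norm_num)).2 h2
  rw [Complex.sq_norm] at h5
  have h6 : normSq Y ≤ normSq (2 + c * Y) := by
    by_contra h
    push Not at h
    nlinarith [mul_pos hcpos (sub_pos.2 h)]
  have h7 : 2 + c * Y ≠ 0 := by
    intro h
    rw [h, map_zero] at h6
    have h8 := normSq_eq_zero.1 (le_antisymm h6 (normSq_nonneg _))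
    simp [h8] at h
  refine ⟨Y / (2 + c * Y), ?_, ?_⟩
  · rw [norm_div, div_le_one (norm_pos_iff.2 h7)]
    refine (sq_le_sq₀ (norm_nonneg _) (norm_nonneg _)).1 ?_
    rwa [Complex.sq_norm, Complex.sq_norm]
  · have h9 : 1 - Y / (2 + c * Y) * c = 2 / (2 + c * Y) := by
      rw [eq_div_iff h7, sub_mul, div_mul_eq_mul_div, div_mul_cancel₀ _ h7]
      ring
    rw [hPY, mul_assoc, mul_comm (deriv P c), ← mul_assoc, h9]
    ring

/-! ### The two pointwise estimates along `z σ_γ (ε z)`. -/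

theorem norm_mul_sigma_lt_one {γ z x : ℂ} (hγ : ‖γ‖ < 1) (hz : ‖z‖ < 1) (hx : ‖x‖ < 1) :
    ‖z * sigma γ x‖ < 1 := by
  rw [norm_mul]
  have := norm_sigma_lt_one hγ hx
  nlinarith [norm_nonneg z, norm_nonneg (sigma γ x)]

theorem norm_mul_lt_one {ε z : ℂ} (hε : ‖ε‖ ≤ 1) (hz : ‖z‖ < 1) : ‖ε * z‖ < 1 := by
  rw [norm_mul]
  nlinarith [norm_nonneg z, norm_nonneg ε]

theorem one_sub_mul_ne_zero {κ w : ℂ} (hκ : ‖κ‖ ≤ 1) (hw : ‖w‖ < 1) : 1 - κ * w ≠ 0 := by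
  intro h
  have h1 := norm_mul_lt_one hκ hw
  rw [← sub_eq_zero.1 h, norm_one] at h1
  exact lt_irrefl _ h1

/-- For a Möbius `P`, the map `b ↦ P (z σ_γ (b z))` is Möbius with denominator `u - b v`. As `|ε v|
< |u|`, it is analytic on `|b| ≤ |ε|` and maps this disk onto a disk; the claim is that the disk
lies strictly inside its tangent half plane at `ε`, apart from the point of contact. -/
theorem IsConformalOnto.re_div_neg {P : ℂ → ℂ} {Ω : Set ℂ} (hP : IsConformalOnto P Ω)
    (hΩ : Convex ℝ Ω) {γ z ε b : ℂ} (hγ : ‖γ‖ < 1) (hz : ‖z‖ < 1) (hz0 : z ≠ 0) (hε : ‖ε‖ ≤ 1)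
    (hε0 : ε ≠ 0) (hb : ‖b‖ ≤ ‖ε‖) (hbε : b ≠ ε) :
    ((P (z * sigma γ (b * z)) - P (z * sigma γ (ε * z))) / (ε * (z ^ 2 *
      (deriv P (z * sigma γ (ε * z)) *
        ((1 - normSq γ) / (1 + (starRingEnd ℂ) γ * (ε * z)) ^ 2))))).re < 0 := by
  have hεz := norm_mul_lt_one hε hz
  have hbz := norm_mul_lt_one (hb.trans hε) hz
  have hwε := norm_mul_sigma_lt_one hγ hz hεz
  have hwb := norm_mul_sigma_lt_one hγ hz hbz
  obtain ⟨κ, hκ, hX⟩ := hP.exists_sub_mul_eq hΩ hwε hwb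
  have hPε := hP.deriv_ne_zero hwε
  have hc0 := one_sub_normSq_ne_zero hγ
  have hdε := one_add_conj_mul_ne_zero hγ hεz.le
  have hdb := one_add_conj_mul_ne_zero hγ hbz.le
  have hκε := one_sub_mul_ne_zero hκ hwε
  have hκb := one_sub_mul_ne_zero hκ hwb
  set u := 1 - κ * z * γ with hu
  set v := z * (κ * z - (starRingEnd ℂ) γ) with hv
  have epε : (1 - κ * (z * sigma γ (ε * z))) * (1 + (starRingEnd ℂ) γ * (ε * z)) = u - ε * v := by
    have : sigma γ (ε * z) * (1 + (starRingEnd ℂ) γ * (ε * z)) = ε * z + γ :=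
      div_mul_cancel₀ _ hdε
    rw [hu, hv]
    linear_combination (-κ * z) * this
  have epb : (1 - κ * (z * sigma γ (b * z))) * (1 + (starRingEnd ℂ) γ * (b * z)) = u - b * v := by
    have : sigma γ (b * z) * (1 + (starRingEnd ℂ) γ * (b * z)) = b * z + γ :=
      div_mul_cancel₀ _ hdb
    rw [hu, hv]
    linear_combination (-κ * z) * this
  have hpb : u - b * v ≠ 0 := epb ▸ mul_ne_zero hκb hdb
  have hpε : u - ε * v ≠ 0 := epε ▸ mul_ne_zero hκε hdε
  have hdiff : z * sigma γ (ε * z) - z * sigma γ (b * z) = z ^ 2 * (1 - normSq γ) * (ε - b) /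
      ((1 + (starRingEnd ℂ) γ * (ε * z)) * (1 + (starRingEnd ℂ) γ * (b * z))) := by
    rw [sigma, sigma, ← mul_conj]
    generalize hA : 1 + (starRingEnd ℂ) γ * (ε * z) = A at hdε ⊢
    generalize hB : 1 + (starRingEnd ℂ) γ * (b * z) = B at hdb ⊢
    field_simp
    rw [← hA, ← hB]
    ring
  have hval : (P (z * sigma γ (b * z)) - P (z * sigma γ (ε * z))) / (ε * (z ^ 2 *
      (deriv P (z * sigma γ (ε * z)) *
        ((1 - normSq γ) / (1 + (starRingEnd ℂ) γ * (ε * z)) ^ 2)))) =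
      -(((ε - b) * (u - ε * v)) / (ε * (u - b * v))) := by
    have h1 : P (z * sigma γ (b * z)) - P (z * sigma γ (ε * z)) =
        -((z * sigma γ (ε * z) - z * sigma γ (b * z)) * deriv P (z * sigma γ (ε * z)) *
        (1 - κ * (z * sigma γ (ε * z))) / (1 - κ * (z * sigma γ (b * z)))) := by
      rw [← hX, mul_div_cancel_right₀ _ hκb, neg_sub]
    rw [h1, hdiff, ← epε, ← epb]
    generalize 1 - κ * (z * sigma γ (ε * z)) = A at hκε ⊢
    generalize 1 - κ * (z * sigma γ (b * z)) = B at hκb ⊢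
    generalize deriv P (z * sigma γ (ε * z)) = p at hPε ⊢
    generalize 1 + (starRingEnd ℂ) γ * (ε * z) = A' at hdε ⊢
    generalize 1 + (starRingEnd ℂ) γ * (b * z) = B' at hdb ⊢
    field_simp
  rw [hval, neg_re, neg_lt_zero, div_re, ← add_div]
  refine div_pos ?_ (normSq_pos.2 (mul_ne_zero hε0 hpb))
  -- The first summand is nonnegative because `|b| ≤ |ε|`, the second is positive because `|ε v| <
  -- |u|` and `b ≠ ε`.
  have hid : ((ε - b) * (u - ε * v)).re * (ε * (u - b * v)).re +
      ((ε - b) * (u - ε * v)).im * (ε * (u - b * v)).im =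
      ((normSq ε - normSq b) * normSq (u - ε * v) +
        (normSq u - normSq (ε * v)) * normSq (ε - b)) / 2 := by
    simp [normSq_apply]
    ring
  rw [hid]
  have h1 : normSq b ≤ normSq ε := by
    rw [← Complex.sq_norm, ← Complex.sq_norm]
    exact pow_le_pow_left₀ (norm_nonneg _) hb 2
  have h2 : 0 < normSq (ε - b) := normSq_pos.2 (sub_ne_zero.2 hbε.symm)
  have h3 : normSq (ε * v) < normSq u := by
    have hκz := norm_mul_lt_one hκ hz
    have h4 := normSq_one_add_sub (a := -(starRingEnd ℂ) γ) (z := κ * z)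
    have h5 : 0 < 1 - normSq (-(starRingEnd ℂ) γ) := by
      apply ofReal_normSq_sub_pos; simpa using hγ
    have h6 := mul_pos h5 (ofReal_normSq_sub_pos hκz)
    have h7 : u = 1 + (starRingEnd ℂ) (-(starRingEnd ℂ) γ) * (κ * z) := by
      simp [hu]; ring
    have h8 : ε * v = (ε * z) * (κ * z + -(starRingEnd ℂ) γ) := by rw [hv]; ring
    rw [h8, map_mul, h7]
    have h9 := ofReal_normSq_sub_pos hεz
    nlinarith [mul_nonneg h9.le (normSq_nonneg (κ * z + -(starRingEnd ℂ) γ))]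
  nlinarith [mul_nonneg (sub_nonneg.2 h1) (normSq_nonneg (u - ε * v)), mul_pos (sub_pos.2 h3) h2]

/-- The derivative of `z ↦ P' (z σ_γ (ε z)) σ_γ' (ε z)` and the convexity inequality it obeys. -/
theorem IsConformalOnto.exists_hasDerivAt_re_pos {P : ℂ → ℂ} {Ω : Set ℂ}
    (hP : IsConformalOnto P Ω) (hΩ : Convex ℝ Ω) {γ z ε : ℂ} (hγ : ‖γ‖ < 1) (hz : ‖z‖ < 1)
    (hε : ‖ε‖ ≤ 1) :
    ∃ d : ℂ, HasDerivAt (fun z => deriv P (z * sigma γ (ε * z)) *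
        ((1 - normSq γ) / (1 + (starRingEnd ℂ) γ * (ε * z)) ^ 2)) d z ∧
      0 < (2 + z * (d / (deriv P (z * sigma γ (ε * z)) *
        ((1 - normSq γ) / (1 + (starRingEnd ℂ) γ * (ε * z)) ^ 2)))).re := by
  have hεz := norm_mul_lt_one hε hz
  have hw := norm_mul_sigma_lt_one hγ hz hεz
  obtain ⟨k, hk, hK⟩ := hP.exists_deriv_deriv_mul_eq hΩ hw
  have hPw := hP.deriv_ne_zero hw
  have hc0 := one_sub_normSq_ne_zero hγ
  have hd := one_add_conj_mul_ne_zero hγ hεz.le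
  have hkw := one_sub_mul_ne_zero hk hw
  have h1 : HasDerivAt (fun z => sigma γ (ε * z))
      ((1 - normSq γ) / (1 + (starRingEnd ℂ) γ * (ε * z)) ^ 2 * ε) z :=
    (hasDerivAt_sigma hd).comp z (by simpa using (hasDerivAt_id z).const_mul ε)
  have h2 : HasDerivAt (fun z => z * sigma γ (ε * z)) (sigma γ (ε * z) +
      z * ((1 - normSq γ) / (1 + (starRingEnd ℂ) γ * (ε * z)) ^ 2 * ε)) z := by
    simpa using (hasDerivAt_id' z).fun_mul h1
  have h3 : HasDerivAt (deriv P) (deriv (deriv P) (z * sigma γ (ε * z))) (z * sigma γ (ε * z)) :=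
    ((hP.differentiableOn.deriv isOpen_ball).differentiableAt
      (isOpen_ball.mem_nhds (mem_ball_zero_iff.2 hw))).hasDerivAt
  have h4 := h3.comp z h2
  have h5 : HasDerivAt (fun z => 1 + (starRingEnd ℂ) γ * (ε * z)) ((starRingEnd ℂ) γ * ε) z := by
    simpa using (((hasDerivAt_id z).const_mul ε).const_mul ((starRingEnd ℂ) γ)).const_add 1
  have h6 := (hasDerivAt_const z (1 - (normSq γ : ℂ))).div (h5.pow 2) (pow_ne_zero 2 hd)
  refine ⟨_, h4.mul h6, ?_⟩
  have hPP : deriv (deriv P) (z * sigma γ (ε * z)) =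
      2 * k * deriv P (z * sigma γ (ε * z)) / (1 - k * (z * sigma γ (ε * z))) := by
    rw [← hK, mul_div_cancel_right₀ _ hkw]
  -- After inserting the Möbius form of `P''`, the expression `2 + z (d / g)` collapses to `2 (1 + k
  -- ε z²) / q`.
  set w := z * sigma γ (ε * z) with hwdef
  set q := 1 + (starRingEnd ℂ) γ * (ε * z) - k * z * (ε * z + γ) with hq
  have hs : sigma γ (ε * z) = (ε * z + γ) / (1 + (starRingEnd ℂ) γ * (ε * z)) := rfl
  have hqe : 1 - k * w = q / (1 + (starRingEnd ℂ) γ * (ε * z)) := by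
    have : sigma γ (ε * z) * (1 + (starRingEnd ℂ) γ * (ε * z)) = ε * z + γ :=
      div_mul_cancel₀ _ hd
    rw [eq_div_iff hd, hwdef, hq]
    linear_combination (-k * z) * this
  have hq0 : q ≠ 0 := by
    intro h; rw [hqe, h, zero_div] at hkw; exact hkw rfl
  have hval : ∀ D : ℂ, D = deriv (deriv P) w * (sigma γ (ε * z) +
      z * ((1 - normSq γ) / (1 + (starRingEnd ℂ) γ * (ε * z)) ^ 2 * ε)) *
      ((1 - normSq γ) / (1 + (starRingEnd ℂ) γ * (ε * z)) ^ 2) + deriv P w *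
      (-((1 - normSq γ) * (2 * (1 + (starRingEnd ℂ) γ * (ε * z)) * ((starRingEnd ℂ) γ * ε))) /
        ((1 + (starRingEnd ℂ) γ * (ε * z)) ^ 2) ^ 2) →
      2 + z * (D / (deriv P w * ((1 - normSq γ) / (1 + (starRingEnd ℂ) γ * (ε * z)) ^ 2))) =
        2 * ((1 + k * ε * z ^ 2) / q) := by
    rintro D rfl
    have e1 : z * (deriv (deriv P) w * (sigma γ (ε * z) +
      z * ((1 - normSq γ) / (1 + (starRingEnd ℂ) γ * (ε * z)) ^ 2 * ε)) *
      ((1 - normSq γ) / (1 + (starRingEnd ℂ) γ * (ε * z)) ^ 2) /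
        (deriv P w * ((1 - normSq γ) / (1 + (starRingEnd ℂ) γ * (ε * z)) ^ 2))) =
        2 * k * z * ((ε * z + γ) * (1 + (starRingEnd ℂ) γ * (ε * z)) + z * (1 - normSq γ) * ε) /
          (q * (1 + (starRingEnd ℂ) γ * (ε * z))) := by
      rw [hPP, hqe, hs]
      field_simp
    have e2 : z * (deriv P w *
      (-((1 - normSq γ) * (2 * (1 + (starRingEnd ℂ) γ * (ε * z)) * ((starRingEnd ℂ) γ * ε))) /
        ((1 + (starRingEnd ℂ) γ * (ε * z)) ^ 2) ^ 2) /
        (deriv P w * ((1 - normSq γ) / (1 + (starRingEnd ℂ) γ * (ε * z)) ^ 2))) =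
        -2 * z * (starRingEnd ℂ) γ * ε / (1 + (starRingEnd ℂ) γ * (ε * z)) := by
      field_simp
    rw [add_div, mul_add, e1, e2, ← mul_conj]
    clear e1 e2
    generalize hA : 1 + (starRingEnd ℂ) γ * (ε * z) = A at *
    field_simp
    rw [hq, ← hA]
    ring
  rw [hval _ (by simp [hwdef])]
  have hre : 0 < ((1 + k * ε * z ^ 2) / q).re := by
    rw [div_re, ← add_div]
    refine div_pos ?_ (normSq_pos.2 hq0)
    have hid : (1 + k * ε * z ^ 2).re * q.re + (1 + k * ε * z ^ 2).im * q.im =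
        1 - normSq k * normSq ε * normSq z ^ 2 +
        ((starRingEnd ℂ) γ * (ε * z)).re * (1 - normSq k * normSq z) -
        (k * γ * z).re * (1 - normSq ε * normSq z) := by
      simp [hq, normSq_apply, pow_two]
      ring
    rw [hid]
    have b1 : -(‖ε‖ * ‖z‖) ≤ ((starRingEnd ℂ) γ * (ε * z)).re := by
      have := (abs_le.1 (abs_re_le_norm ((starRingEnd ℂ) γ * (ε * z)))).1
      rw [norm_mul, norm_mul, RCLike.norm_conj] at this
      nlinarith [mul_nonneg (norm_nonneg ε) (norm_nonneg z)]
    have b2 : (k * γ * z).re ≤ ‖k‖ * ‖z‖ := by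
      have := (abs_le.1 (abs_re_le_norm (k * γ * z))).2
      rw [norm_mul, norm_mul] at this
      nlinarith [mul_nonneg (norm_nonneg k) (norm_nonneg z)]
    have hkz := norm_mul_lt_one hk hz
    rw [norm_mul] at hkz hεz
    simp only [← Complex.sq_norm]
    have p1 : 0 ≤ 1 - ‖k‖ ^ 2 * ‖z‖ ^ 2 := by
      nlinarith [mul_nonneg (norm_nonneg k) (norm_nonneg z)]
    have p2 : 0 ≤ 1 - ‖ε‖ ^ 2 * ‖z‖ ^ 2 := by
      nlinarith [mul_nonneg (norm_nonneg ε) (norm_nonneg z)]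
    have p3 : 0 < 1 - (‖k‖ * ‖z‖) * (‖ε‖ * ‖z‖) := by
      nlinarith [mul_nonneg (norm_nonneg ε) (norm_nonneg z),
        mul_nonneg (norm_nonneg k) (norm_nonneg z)]
    -- With `e = ‖ε‖ ‖z‖` and `m = ‖k‖ ‖z‖`, the lower bound `1 - e² m² - e (1 - m²) - m (1 - e²)`
    -- factors as `(1 - e m) (1 - e) (1 - m)`.
    have p4 := mul_pos p3 (mul_pos (sub_pos.2 hεz) (sub_pos.2 hkz))
    have p5 := mul_le_mul_of_nonneg_right b1 p1
    have p6 := mul_le_mul_of_nonneg_right b2 p2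
    nlinarith
  have : (2 * ((1 + k * ε * z ^ 2) / q)).re = 2 * ((1 + k * ε * z ^ 2) / q).re := by simp
  rw [this]
  linarith

/-! ### Jack's lemma, starlikeness and Libera's lemma. -/

/-- For `Re c ≤ 0` and `t ≥ 0` the curve `z exp (c t)` stays in the disk of radius `‖z‖`. Varying
`c` over the half plane tests an extremum on that disk in every admissible direction. -/
theorem hasDerivAt_comp_mul_exp {M : ℂ → ℂ} {m z : ℂ} (hM : HasDerivAt M m z) (c : ℂ) :
    HasDerivAt (fun t : ℝ => M (z * exp (c * t))) (m * (z * c)) 0 := by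
  have h1 : HasDerivAt (fun t : ℂ => z * exp (c * t)) (z * c) ((0 : ℝ) : ℂ) := by
    have := (((hasDerivAt_id' ((0 : ℝ) : ℂ)).const_mul c).cexp).const_mul z
    simpa using this
  have h2 : HasDerivAt M m (z * exp (c * ((0 : ℝ) : ℂ))) := by simpa using hM
  exact (HasDerivAt.comp (h₂ := M) ((0 : ℝ) : ℂ) h2 h1).comp_ofReal

theorem norm_mul_exp_le {z c : ℂ} {t : ℝ} (hc : c.re ≤ 0) (ht : 0 ≤ t) :
    ‖z * exp (c * t)‖ ≤ ‖z‖ := by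
  rw [norm_mul, norm_exp]
  refine mul_le_of_le_one_right (norm_nonneg z) (Real.exp_le_one_iff.2 ?_)
  rw [mul_comm, re_ofReal_mul]
  exact mul_nonpos_of_nonneg_of_nonpos ht hc

theorem exists_nonneg_eq_of_re_mul_nonpos {x : ℂ} (h : ∀ c : ℂ, c.re ≤ 0 → (x * c).re ≤ 0) :
    ∃ s : ℝ, 0 ≤ s ∧ x = s := by
  have h1 := h (-1) (by simp)
  have h2 := h I (by simp)
  have h3 := h (-I) (by simp)
  simp at h1 h2 h3
  exact ⟨x.re, h1, Complex.ext (by simp) (by simpa using le_antisymm h3 h2)⟩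

/-- Jack's lemma: where `Re M` is maximal on a closed disk around `0`, `z M' z` is real and
nonnegative. -/
theorem exists_nonneg_mul_deriv_eq {M : ℂ → ℂ} {m z : ℂ} (hM : HasDerivAt M m z)
    (hmax : ∀ w : ℂ, ‖w‖ ≤ ‖z‖ → (M w).re ≤ (M z).re) : ∃ s : ℝ, 0 ≤ s ∧ z * m = s := by
  refine exists_nonneg_eq_of_re_mul_nonpos fun c hc => ?_
  have h1 := (reCLM.hasFDerivAt.comp_hasDerivAt (0 : ℝ) (hasDerivAt_comp_mul_exp hM c))
  have h2 := nonpos_of_hasDerivAt_of_eventually_le h1 (by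
    filter_upwards [self_mem_nhdsWithin] with t ht
    simpa using hmax _ (norm_mul_exp_le (z := z) hc (le_of_lt ht)))
  have h3 : z * m * c = m * (z * c) := by ring
  rw [h3]
  exact h2

/-- A function `z² G` whose derivative is `z g` is (two-valently) starlike if it is convex. -/
theorem re_div_pos_of_convex {G G' g d : ℂ → ℂ}
    (hG : ∀ z, ‖z‖ < 1 → HasDerivAt G (G' z) z) (hg : ∀ z, ‖z‖ < 1 → HasDerivAt g (d z) z)
    (hgG : ∀ z, ‖z‖ < 1 → g z = 2 * G z + z * G' z) (hg0 : ∀ z, ‖z‖ < 1 → g z ≠ 0)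
    (hJ : ∀ z, ‖z‖ < 1 → 0 < (2 + z * (d z / g z)).re) {z : ℂ} (hz : ‖z‖ < 1) :
    0 < (G z / g z).re := by
  by_contra hneg
  push Not at hneg
  set q : ℂ → ℂ := fun z => G z / g z with hq
  have hq' : ∀ z, ‖z‖ < 1 → HasDerivAt q ((G' z * g z - G z * d z) / g z ^ 2) z := fun z hz =>
    (hG z hz).div (hg z hz) (hg0 z hz)
  -- The relation `g = 2 G + z G'` becomes a first-order equation for `q = G / g`; at the origin it
  -- gives `q 0 = 1/2`.
  have heq : ∀ z, ‖z‖ < 1 → 1 = q z * (2 + z * (d z / g z)) +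
      z * ((G' z * g z - G z * d z) / g z ^ 2) := by
    intro z hz
    have h0 := hg0 z hz
    have h1 := hgG z hz
    simp only [hq]
    field_simp
    linear_combination g z * h1
  have hqc : ContinuousOn (fun z => (q z).re) (ball 0 1) := fun z hz =>
    (continuous_re.continuousAt.comp (hq' z (mem_ball_zero_iff.1 hz)).continuousAt).continuousWithinAt
  have hcomp : IsCompact {w ∈ closedBall (0 : ℂ) ‖z‖ | (q w).re ≤ 0} := by
    have h1 := (hqc.mono (closedBall_subset_ball hz)).preimage_isClosed_of_isClosed
      isClosed_closedBall (isClosed_Iic (a := (0 : ℝ)))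
    exact (isCompact_closedBall (0 : ℂ) ‖z‖).of_isClosed_subset h1 inter_subset_left
  -- A failure point of least modulus: there `Re q = 0` is the minimum over the disk of radius
  -- `‖z₁‖`, so Jack's lemma applies to `-q`.
  obtain ⟨z₁, ⟨hz₁, hqz₁⟩, hmin⟩ := hcomp.exists_isMinOn ⟨z, by simp, hneg⟩
    continuous_norm.continuousOn
  rw [mem_closedBall_zero_iff] at hz₁
  have hz₁1 := hz₁.trans_lt hz
  have hpos : ∀ w : ℂ, ‖w‖ < ‖z₁‖ → 0 < (q w).re := by
    intro w hw
    by_contra h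
    push Not at h
    have := hmin (show w ∈ {w ∈ closedBall (0 : ℂ) ‖z‖ | (q w).re ≤ 0} from
      ⟨mem_closedBall_zero_iff.2 (hw.le.trans hz₁), h⟩)
    exact absurd hw (not_lt.2 this)
  have hz₁0 : z₁ ≠ 0 := by
    rintro rfl
    have h1 := congrArg Complex.re (heq 0 (by simp))
    simp at h1
    linarith
  have hnn : ∀ w : ℂ, ‖w‖ ≤ ‖z₁‖ → 0 ≤ (q w).re := by
    intro w hw
    have h1 : ContinuousAt (fun t : ℝ => (q (t * w)).re) 1 := by
      have h2 : ContinuousAt q (((1 : ℝ) : ℂ) * w) := by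
        simpa using (hq' w (hw.trans_lt hz₁1)).continuousAt
      exact continuous_re.continuousAt.comp
        (ContinuousAt.comp (g := q) (f := fun t : ℝ => (t : ℂ) * w) h2 (by fun_prop))
    have h2 := h1.tendsto.mono_left (nhdsWithin_le_nhds (s := Iio (1 : ℝ)))
    simp only [ofReal_one, one_mul] at h2
    refine ge_of_tendsto h2 ?_
    filter_upwards [Ioo_mem_nhdsLT (zero_lt_one (α := ℝ))] with t ht
    refine (hpos _ ?_).le
    rw [norm_mul, norm_real, Real.norm_of_nonneg ht.1.le]
    nlinarith [ht.2, norm_pos_iff.2 hz₁0, ht.1]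
  have hre : (q z₁).re = 0 := le_antisymm hqz₁ (hnn z₁ le_rfl)
  obtain ⟨s, hs, hse⟩ := exists_nonneg_mul_deriv_eq (hq' z₁ hz₁1).neg (fun w hw => by
    simpa [hre] using hnn w hw)
  have h1 := heq z₁ hz₁1
  -- Here `q z₁` is purely imaginary and the left side is positive, so `q z₁ ≠ 0` and the other
  -- factor would have zero real part, against `hJ`.
  have h2 : (1 : ℂ) + s = q z₁ * (2 + z₁ * (d z₁ / g z₁)) := by
    rw [← hse]; linear_combination h1
  have h3 := hJ z₁ hz₁1
  have h4 := congrArg Complex.re h2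
  have h5 := congrArg Complex.im h2
  rw [mul_re, hre] at h4
  rw [mul_im, hre] at h5
  simp only [add_re, one_re, ofReal_re, add_im, one_im, ofReal_im, add_zero, zero_mul,
    zero_sub, zero_add] at h4 h5
  rcases mul_eq_zero.1 h5.symm with h6 | h6
  · rw [h6, zero_mul] at h4; linarith
  · rw [add_re] at h3; linarith

/-- Libera's lemma for the quotient `z² A / (z² G)`, whose quotient of derivatives is `a / g`. -/
theorem re_div_nonpos_of_starlike {A A' a G G' g : ℂ → ℂ}
    (hA : ∀ z, ‖z‖ < 1 → HasDerivAt A (A' z) z) (hG : ∀ z, ‖z‖ < 1 → HasDerivAt G (G' z) z)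
    (haA : ∀ z, ‖z‖ < 1 → a z = 2 * A z + z * A' z)
    (hgG : ∀ z, ‖z‖ < 1 → g z = 2 * G z + z * G' z)
    (hGg : ∀ z, ‖z‖ < 1 → 0 < (G z / g z).re)
    (hag : ∀ z, ‖z‖ < 1 → z ≠ 0 → (a z / g z).re ≤ 0) {z : ℂ} (hz : ‖z‖ < 1) :
    (A z / G z).re ≤ 0 ∧
      ((A z / G z).re = 0 → ∀ w, ‖w‖ < 1 → w ≠ 0 → (a w / g w).re = 0) := by
  have hG0 : ∀ z, ‖z‖ < 1 → G z ≠ 0 := fun z hz h => by simpa [h] using hGg z hz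
  have hg0 : ∀ z, ‖z‖ < 1 → g z ≠ 0 := fun z hz h => by simpa [h] using hGg z hz
  set M : ℂ → ℂ := fun z => A z / G z with hM
  set M' : ℂ → ℂ := fun z => (A' z * G z - A z * G' z) / G z ^ 2 with hM'
  have hMd : ∀ z, ‖z‖ < 1 → HasDerivAt M (M' z) z := fun z hz =>
    (hA z hz).div (hG z hz) (hG0 z hz)
  -- Where `Re M` is maximal on a circle, `z M'` equals some `s ≥ 0`, so `Re M + s Re (G / g) = Re
  -- (a / g) ≤ 0` forces `Re M ≤ 0`.
  have heq : ∀ z, ‖z‖ < 1 → a z / g z = M z + z * M' z * (G z / g z) := by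
    intro z hz
    have h1 := hG0 z hz
    have h2 := hg0 z hz
    simp only [hM, hM']
    field_simp
    rw [haA z hz, hgG z hz]
    ring
  have hle : ∀ w : ℂ, ‖w‖ < 1 → (M w).re ≤ 0 := by
    intro w hw
    obtain ⟨r, hwr, hr1⟩ := exists_between hw
    have hr : 0 < r := (norm_nonneg w).trans_lt hwr
    have hsub : closedBall (0 : ℂ) r ⊆ ball 0 1 := closedBall_subset_ball hr1
    have hdc : DiffContOnCl ℂ (fun z => exp (M z)) (ball 0 r) := by
      refine DifferentiableOn.diffContOnCl fun z hz => ?_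
      rw [closure_ball _ hr.ne'] at hz
      exact (hMd z (mem_ball_zero_iff.1 (hsub hz))).cexp.differentiableAt.differentiableWithinAt
    obtain ⟨z₁, hz₁, hmax⟩ := exists_mem_frontier_isMaxOn_norm isBounded_ball
      ⟨0, mem_ball_self hr⟩ hdc
    rw [frontier_ball _ hr.ne', mem_sphere_zero_iff_norm] at hz₁
    rw [closure_ball _ hr.ne'] at hmax
    have hmax' : ∀ v : ℂ, ‖v‖ ≤ ‖z₁‖ → (M v).re ≤ (M z₁).re := by
      intro v hv
      have := hmax (mem_closedBall_zero_iff.2 (hv.trans hz₁.le))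
      simpa [norm_exp] using this
    have hz₁1 : ‖z₁‖ < 1 := hz₁ ▸ hr1
    obtain ⟨s, hs, hse⟩ := exists_nonneg_mul_deriv_eq (hMd z₁ hz₁1) hmax'
    have h1 := hag z₁ hz₁1 (norm_pos_iff.1 (hz₁ ▸ hr))
    rw [heq z₁ hz₁1, hse, add_re, re_ofReal_mul] at h1
    have h2 := hmax' w (hz₁ ▸ hwr.le)
    nlinarith [mul_nonneg hs (hGg z₁ hz₁1).le]
  refine ⟨hle z hz, fun h0 w hw hw0 => ?_⟩
  have hd : DifferentiableOn ℂ (fun z => exp (M z)) (ball 0 1) := fun z hz =>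
    (hMd z (mem_ball_zero_iff.1 hz)).cexp.differentiableAt.differentiableWithinAt
  -- Equality at an interior point makes `|exp M|` attain its maximum; then `M` is constant and `a /
  -- g = M`.
  have hconst := eq_const_of_exists_max hd (mem_ball_zero_iff.2 hz) (fun v hv => by
    have := hle v (mem_ball_zero_iff.1 hv)
    have h0' : (M z).re = 0 := h0
    simpa [norm_exp, h0'] using this)
  have hM'0 : M' w = 0 := by
    have h1 := (hMd w hw).cexp
    have h2 : HasDerivAt (fun z => exp (M z)) 0 w :=
      (hasDerivAt_const w (exp (M z))).congr_of_eventuallyEq (by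
        filter_upwards [isOpen_ball.mem_nhds (mem_ball_zero_iff.2 hw)] with v hv using hconst hv)
    exact (mul_eq_zero.1 (h1.unique h2)).resolve_left (exp_ne_zero _)
  rw [heq w hw, hM'0]
  have h1 := hconst (mem_ball_zero_iff.2 hw)
  have h2 := congrArg norm h1
  simp only [Function.const_apply, norm_exp, Real.exp_eq_exp] at h2
  simp only [mul_zero, zero_mul, add_zero]
  rw [h2]; exact h0

/-! ### Tangent half planes and convexity of the image. -/

theorem div_re_eq (x y : ℂ) : (x / y).re = (x * (starRingEnd ℂ) y).re / normSq y := by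
  rw [div_re, ← add_div]; simp

theorem re_mul_conj_neg_iff {x y : ℂ} (hy : y ≠ 0) :
    (x * (starRingEnd ℂ) y).re < 0 ↔ (x / y).re < 0 := by
  rw [div_re_eq, div_lt_iff₀ (normSq_pos.2 hy), zero_mul]

theorem re_mul_conj_nonpos_iff {x y : ℂ} (hy : y ≠ 0) :
    (x * (starRingEnd ℂ) y).re ≤ 0 ↔ (x / y).re ≤ 0 := by
  rw [div_re_eq, div_le_iff₀ (normSq_pos.2 hy), zero_mul]

/-- A point in all the tangent half planes of the curve `q (e^{it})` is covered by `q`. -/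
theorem mem_image_closedBall_of_re_le {q q' : ℂ → ℂ}
    (hq : ∀ ε, ‖ε‖ ≤ 1 → HasDerivAt q (q' ε) ε) (hq0 : ∀ ε, ‖ε‖ = 1 → q' ε ≠ 0) {w : ℂ}
    (hw : ∀ ε, ‖ε‖ = 1 → ((w - q ε) * (starRingEnd ℂ) (ε * q' ε)).re ≤ 0) :
    w ∈ q '' closedBall 0 1 := by
  by_contra hnot
  have hne : ∀ ε, ‖ε‖ ≤ 1 → w - q ε ≠ 0 := fun ε hε h =>
    hnot ⟨ε, mem_closedBall_zero_iff.2 hε, (sub_eq_zero.1 h).symm⟩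
  -- If `w` is not covered, the maximum principle for `1 / (w - q)` places a nearest image point on
  -- the boundary curve.
  have hdc : DiffContOnCl ℂ (fun ε => (w - q ε)⁻¹) (ball 0 1) := by
    refine DifferentiableOn.diffContOnCl fun ε hε => ?_
    rw [closure_ball _ one_ne_zero, mem_closedBall_zero_iff] at hε
    exact (((hq ε hε).const_sub w).inv (hne ε hε)).differentiableAt.differentiableWithinAt
  obtain ⟨ε, hε, hmax⟩ := exists_mem_frontier_isMaxOn_norm isBounded_ball
    ⟨0, mem_ball_self one_pos⟩ hdc
  rw [frontier_ball _ one_ne_zero, mem_sphere_zero_iff_norm] at hε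
  rw [closure_ball _ one_ne_zero] at hmax
  have hmin : ∀ v : ℂ, ‖v‖ ≤ 1 → ‖w - q ε‖ ≤ ‖w - q v‖ := by
    intro v hv
    have := hmax (mem_closedBall_zero_iff.2 hv)
    simp only [mem_ofPred_eq, Function.comp_apply, norm_inv] at this
    exact (inv_le_inv₀ (norm_pos_iff.2 (hne v hv)) (norm_pos_iff.2 (hne ε hε.le))).1 this
  -- At the nearest point, `w - q ε` is a nonnegative multiple of the outward normal `ε q' ε`; the
  -- half-plane condition then forces it to vanish.
  have hx : ∃ s : ℝ, 0 ≤ s ∧ (starRingEnd ℂ) (w - q ε) * (ε * q' ε) = s := by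
    refine exists_nonneg_eq_of_re_mul_nonpos fun c hc => ?_
    have h1 := ((hasDerivAt_comp_mul_exp (hq ε hε.le) c).const_sub w).norm_sq.neg
    have h2 := nonpos_of_hasDerivAt_of_eventually_le h1 (by
      filter_upwards [self_mem_nhdsWithin] with t ht
      have h3 := hmin (ε * exp (c * t)) (hε ▸ norm_mul_exp_le (z := ε) hc (le_of_lt ht))
      simp only [Pi.neg_apply, ofReal_zero, mul_zero, exp_zero, mul_one]
      exact neg_le_neg (pow_le_pow_left₀ (norm_nonneg _) h3 2))
    simp only [ofReal_zero, mul_zero, exp_zero, mul_one, Complex.inner] at h2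
    have h4 : (starRingEnd ℂ) (w - q ε) * (ε * q' ε) * c =
        -(-(q' ε * (ε * c)) * (starRingEnd ℂ) (w - q ε)) := by ring
    rw [h4, neg_re]
    linarith
  obtain ⟨s, hs, hse⟩ := hx
  have h1 := hw ε hε
  have h2 : (w - q ε) * (starRingEnd ℂ) (ε * q' ε) = s := by
    have := congrArg (starRingEnd ℂ) hse
    rwa [map_mul, conj_conj, conj_ofReal] at this
  rw [h2, ofReal_re] at h1
  have hs0 : s = 0 := le_antisymm h1 hs
  rw [hs0, ofReal_zero] at h2
  have hε0 : ε ≠ 0 := norm_pos_iff.1 (hε ▸ one_pos)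
  exact (mul_ne_zero (hne ε hε.le)
    ((map_ne_zero _).2 (mul_ne_zero hε0 (hq0 ε hε)))) h2

/-- Of two points with the same image, the one of larger modulus plays the part of `ε`. -/
theorem injOn_closedBall_of_re_lt {q q' : ℂ → ℂ}
    (hlt : ∀ ε b, ‖ε‖ ≤ 1 → ‖b‖ ≤ ‖ε‖ → b ≠ ε → ((q b - q ε) / (ε * q' ε)).re < 0) :
    InjOn q (closedBall 0 1) := by
  have key : ∀ ε b : ℂ, ‖ε‖ ≤ 1 → ‖b‖ ≤ ‖ε‖ → q b = q ε → b = ε := by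
    intro ε b hε hb h
    by_contra hne
    simpa [h] using hlt ε b hε hb hne
  intro x hx y hy h
  rw [mem_closedBall_zero_iff] at hx hy
  rcases le_total ‖x‖ ‖y‖ with hxy | hxy
  · exact key y x hy hxy h
  · exact (key x y hx hxy h.symm).symm

theorem re_mul_conj_neg_of_re_lt {q q' : ℂ → ℂ} (hq0 : ∀ ε, ‖ε‖ ≤ 1 → q' ε ≠ 0)
    (hlt : ∀ ε b, ‖ε‖ ≤ 1 → ‖b‖ ≤ ‖ε‖ → b ≠ ε → ((q b - q ε) / (ε * q' ε)).re < 0)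
    {ε b : ℂ} (hε : ‖ε‖ = 1) (hb : ‖b‖ ≤ 1) (hne : b ≠ ε) :
    ((q b - q ε) * (starRingEnd ℂ) (ε * q' ε)).re < 0 :=
  (re_mul_conj_neg_iff (mul_ne_zero (norm_pos_iff.1 (hε ▸ one_pos)) (hq0 ε hε.le))).2
    (hlt ε b hε.le (hε ▸ hb) hne)

theorem image_closedBall_eq_of_re_lt {q q' : ℂ → ℂ}
    (hq : ∀ ε, ‖ε‖ ≤ 1 → HasDerivAt q (q' ε) ε) (hq0 : ∀ ε, ‖ε‖ ≤ 1 → q' ε ≠ 0)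
    (hlt : ∀ ε b, ‖ε‖ ≤ 1 → ‖b‖ ≤ ‖ε‖ → b ≠ ε → ((q b - q ε) / (ε * q' ε)).re < 0) :
    q '' closedBall 0 1 =
    ⋂ (ε : ℂ) (_ : ‖ε‖ = 1), {w | ((w - q ε) * (starRingEnd ℂ) (ε * q' ε)).re ≤ 0} := by
  ext w
  simp only [mem_iInter, mem_ofPred_eq]
  refine ⟨?_, mem_image_closedBall_of_re_le hq fun ε hε => hq0 ε hε.le⟩
  rintro ⟨b, hb, rfl⟩ ε hε
  rcases eq_or_ne b ε with rfl | hne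
  · simp
  · exact (re_mul_conj_neg_of_re_lt hq0 hlt hε (mem_closedBall_zero_iff.1 hb) hne).le

theorem image_ball_eq_of_re_lt {q q' : ℂ → ℂ}
    (hq : ∀ ε, ‖ε‖ ≤ 1 → HasDerivAt q (q' ε) ε) (hq0 : ∀ ε, ‖ε‖ ≤ 1 → q' ε ≠ 0)
    (hlt : ∀ ε b, ‖ε‖ ≤ 1 → ‖b‖ ≤ ‖ε‖ → b ≠ ε → ((q b - q ε) / (ε * q' ε)).re < 0) :
    q '' ball 0 1 =
    ⋂ (ε : ℂ) (_ : ‖ε‖ = 1), {w | ((w - q ε) * (starRingEnd ℂ) (ε * q' ε)).re < 0} := by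
  ext w
  simp only [mem_iInter, mem_ofPred_eq]
  constructor
  · rintro ⟨b, hb, rfl⟩ ε hε
    rw [mem_ball_zero_iff] at hb
    exact re_mul_conj_neg_of_re_lt hq0 hlt hε hb.le (by rintro rfl; exact hb.ne hε)
  · intro h
    obtain ⟨b, hb, rfl⟩ := mem_image_closedBall_of_re_le hq (fun ε hε => hq0 ε hε.le)
      fun ε hε => (h ε hε).le
    rw [mem_closedBall_zero_iff] at hb
    rcases hb.lt_or_eq with hb | hb
    · exact ⟨b, mem_ball_zero_iff.2 hb, rfl⟩
    · simpa using h b hb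

theorem isLinearMap_re_mul (c : ℂ) : IsLinearMap ℝ fun w : ℂ => (w * c).re where
  map_add x y := by rw [add_mul, add_re]
  map_smul r x := by simp [mul_assoc]

theorem convex_image_closedBall_of_re_lt {q q' : ℂ → ℂ}
    (hq : ∀ ε, ‖ε‖ ≤ 1 → HasDerivAt q (q' ε) ε) (hq0 : ∀ ε, ‖ε‖ ≤ 1 → q' ε ≠ 0)
    (hlt : ∀ ε b, ‖ε‖ ≤ 1 → ‖b‖ ≤ ‖ε‖ → b ≠ ε → ((q b - q ε) / (ε * q' ε)).re < 0) :
    Convex ℝ (q '' closedBall 0 1) := by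
  rw [image_closedBall_eq_of_re_lt hq hq0 hlt]
  refine convex_iInter₂ fun ε _ => ?_
  simp only [sub_mul, sub_re, tsub_le_iff_right, zero_add]
  exact convex_halfSpace_le (isLinearMap_re_mul _) _

theorem convex_image_ball_of_re_lt {q q' : ℂ → ℂ}
    (hq : ∀ ε, ‖ε‖ ≤ 1 → HasDerivAt q (q' ε) ε) (hq0 : ∀ ε, ‖ε‖ ≤ 1 → q' ε ≠ 0)
    (hlt : ∀ ε b, ‖ε‖ ≤ 1 → ‖b‖ ≤ ‖ε‖ → b ≠ ε → ((q b - q ε) / (ε * q' ε)).re < 0) :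
    Convex ℝ (q '' ball 0 1) := by
  rw [image_ball_eq_of_re_lt hq hq0 hlt]
  refine convex_iInter₂ fun ε _ => ?_
  simp only [sub_mul, sub_re, sub_neg]
  exact convex_halfSpace_lt (isLinearMap_re_mul _) _

/-! ### Primitives along segments. -/

theorem norm_ofReal_mul_lt_one {z : ℂ} (hz : ‖z‖ < 1) {t : ℝ} (ht : t ∈ Icc (0 : ℝ) 1) :
    ‖(t : ℂ) * z‖ < 1 := by
  refine norm_mul_lt_one ?_ hz
  rw [norm_real, Real.norm_of_nonneg ht.1]
  exact ht.2

theorem continuousOn_comp_ofReal_mul {h : ℂ → ℂ} (hh : ContinuousOn h (ball 0 1)) {z : ℂ}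
    (hz : ‖z‖ < 1) : ContinuousOn (fun t : ℝ => h ((t : ℂ) * z) * z) (Icc 0 1) :=
  ContinuousOn.mul (hh.comp (by fun_prop) fun _ ht =>
    mem_ball_zero_iff.2 (norm_ofReal_mul_lt_one hz ht)) continuousOn_const

theorem eq_segInt_of_hasDerivAt {H h : ℂ → ℂ} (hh : ContinuousOn h (ball 0 1))
    (hH : ∀ z, ‖z‖ < 1 → HasDerivAt H (h z) z) (hH0 : H 0 = 0) {z : ℂ} (hz : ‖z‖ < 1) :
    H z = segInt h z := by
  have h1 : ∀ t ∈ uIcc (0 : ℝ) 1, HasDerivAt (fun t : ℝ => H ((t : ℂ) * z))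
      (h ((t : ℂ) * z) * z) t := by
    intro t ht
    rw [uIcc_of_le zero_le_one] at ht
    have h2 : HasDerivAt (fun t : ℂ => t * z) z (t : ℂ) := by
      simpa using (hasDerivAt_id' (t : ℂ)).mul_const z
    exact (HasDerivAt.comp (h₂ := H) (t : ℂ) (hH _ (norm_ofReal_mul_lt_one hz ht)) h2).comp_ofReal
  have h3 := intervalIntegral.integral_eq_sub_of_hasDerivAt h1
    (ContinuousOn.intervalIntegrable (by
      rw [uIcc_of_le zero_le_one]; exact continuousOn_comp_ofReal_mul hh hz))
  rw [segInt, h3]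
  simp [hH0]

theorem hasDerivAt_segInt {h : ℂ → ℂ} (hh : DifferentiableOn ℂ h (ball 0 1)) {z : ℂ}
    (hz : ‖z‖ < 1) : HasDerivAt (segInt h) (h z) z := by
  obtain ⟨H, hH0, hH⟩ := hh.isExactOn_ball.with_val_at 0 0
  have hH' : ∀ z, ‖z‖ < 1 → HasDerivAt H (h z) z := fun z hz => hH z (mem_ball_zero_iff.2 hz)
  refine (hH' z hz).congr_of_eventuallyEq ?_
  filter_upwards [isOpen_ball.mem_nhds (mem_ball_zero_iff.2 hz)] with w hw
  exact (eq_segInt_of_hasDerivAt hh.continuousOn hH' hH0 (mem_ball_zero_iff.1 hw)).symm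

theorem segInt_zero (h : ℂ → ℂ) : segInt h 0 = 0 := by simp [segInt]

/-- A single point of the segment does not affect the integral. This matters at `0`, where `ζ⁻¹ * (P
(⋯) - 1)` has the default value `0` instead of its limit. -/
theorem segInt_congr {h k : ℂ → ℂ} (hhk : ∀ z, ‖z‖ < 1 → z ≠ 0 → h z = k z) {z : ℂ}
    (hz : ‖z‖ < 1) : segInt h z = segInt k z := by
  rcases eq_or_ne z 0 with rfl | hz0
  · rw [segInt_zero, segInt_zero]
  refine intervalIntegral.integral_congr_ae (Eventually.of_forall fun t ht => ?_)
  rw [uIoc_of_le zero_le_one] at ht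
  rw [hhk _ (norm_ofReal_mul_lt_one hz ⟨ht.1.le, ht.2⟩)
    (mul_ne_zero (ofReal_ne_zero.2 ht.1.ne') hz0)]

theorem eqOn_ball_of_ne_zero {h k : ℂ → ℂ} (hh : ContinuousOn h (ball 0 1))
    (hk : ContinuousOn k (ball 0 1)) (hhk : ∀ z, ‖z‖ < 1 → z ≠ 0 → h z = k z) {z : ℂ}
    (hz : ‖z‖ < 1) : h z = k z := by
  rcases eq_or_ne z 0 with rfl | hz0
  · have hD : ball (0 : ℂ) 1 ∈ 𝓝 (0 : ℂ) := ball_mem_nhds 0 one_pos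
    have h1 := (hh.continuousAt hD).tendsto.mono_left (nhdsWithin_le_nhds (s := {(0 : ℂ)}ᶜ))
    have h2 := (hk.continuousAt hD).tendsto.mono_left (nhdsWithin_le_nhds (s := {(0 : ℂ)}ᶜ))
    refine tendsto_nhds_unique h1 (h2.congr' ?_)
    filter_upwards [self_mem_nhdsWithin, nhdsWithin_le_nhds hD] with w hw hw'
    exact (hhk w (mem_ball_zero_iff.1 hw') hw).symm
  · exact hhk z hz hz0

theorem hasDerivAt_of_norm_lt {h : ℂ → ℂ} (hh : DifferentiableOn ℂ h (ball 0 1))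
    {z : ℂ} (hz : ‖z‖ < 1) : HasDerivAt h (deriv h z) z :=
  (hh.differentiableAt (isOpen_ball.mem_nhds (mem_ball_zero_iff.2 hz))).hasDerivAt

theorem differentiableOn_dslope_zero {h : ℂ → ℂ} (hh : DifferentiableOn ℂ h (ball 0 1)) :
    DifferentiableOn ℂ (dslope h 0) (ball 0 1) :=
  (differentiableOn_dslope (ball_mem_nhds 0 one_pos)).2 hh

/-- The primitive of `z a` is `z² A` with `2 A + z A' = a`. -/
theorem exists_two_mul_add {a : ℂ → ℂ} (ha : DifferentiableOn ℂ a (ball 0 1)) :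
    ∃ A : ℂ → ℂ, DifferentiableOn ℂ A (ball 0 1) ∧
      (∀ z, ‖z‖ < 1 → a z = 2 * A z + z * deriv A z) ∧
      ∀ z, ‖z‖ < 1 → segInt (fun ζ => ζ * a ζ) z = z ^ 2 * A z := by
  set B := segInt fun ζ => ζ * a ζ with hB
  have hBd : ∀ z, ‖z‖ < 1 → HasDerivAt B (z * a z) z := fun z hz =>
    hasDerivAt_segInt (h := fun ζ => ζ * a ζ) (differentiableOn_id.mul ha) hz
  have hBD : DifferentiableOn ℂ B (ball 0 1) := fun z hz =>
    (hBd z (mem_ball_zero_iff.1 hz)).differentiableAt.differentiableWithinAt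
  have hB1 := differentiableOn_dslope_zero hBD
  have hA := differentiableOn_dslope_zero hB1
  have hBA : ∀ z, B z = z ^ 2 * dslope (dslope B 0) 0 z := by
    intro z
    have h0 : dslope B 0 0 = 0 := by
      rw [dslope_same, (hBd 0 (by simp)).deriv, zero_mul]
    have h1 := sub_smul_dslope B 0 z
    have h2 := sub_smul_dslope (dslope B 0) 0 z
    rw [h0] at h2
    simp only [sub_zero, smul_eq_mul, hB, segInt_zero] at h1 h2 ⊢
    rw [pow_two, mul_assoc, h2, h1]
  refine ⟨dslope (dslope B 0) 0, hA, fun z hz => ?_, fun z _ => hBA z⟩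
  refine eqOn_ball_of_ne_zero (h := a)
    (k := fun z => 2 * dslope (dslope B 0) 0 z + z * deriv (dslope (dslope B 0) 0) z)
    ha.continuousOn ?_ (fun z hz hz0 => ?_) hz
  · exact (continuousOn_const.mul hA.continuousOn).add
      (continuousOn_id.mul (hA.deriv isOpen_ball).continuousOn)
  · have h1 : HasDerivAt (fun z => z ^ 2 * dslope (dslope B 0) 0 z)
        (2 * z * dslope (dslope B 0) 0 z + z ^ 2 * deriv (dslope (dslope B 0) 0) z) z := by
      simpa using ((hasDerivAt_id' z).fun_pow 2).fun_mul
        (hasDerivAt_of_norm_lt hA hz)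
    have h2 : HasDerivAt B _ z := h1.congr_of_eventuallyEq (Eventually.of_forall hBA)
    have h3 := (hBd z hz).unique h2
    refine mul_left_cancel₀ hz0 (h3.trans ?_)
    ring

/-! ### Parametrization of the class by bounded analytic functions. -/

section Parametrization

variable {P : ℂ → ℂ} {Ω : Set ℂ}

theorem sub_eq_mul_dslope (P : ℂ → ℂ) (w : ℂ) : P w - P 0 = w * dslope P 0 w := by
  simpa using (sub_smul_dslope P 0 w).symm

/-- When `P 0 = 1`, this is `(P (z s) - 1) / z` with its removable singularity at `0` filled in. -/
theorem differentiableOn_mul_dslope (hP : DifferentiableOn ℂ P (ball 0 1)) {s : ℂ → ℂ}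
    (hs : DifferentiableOn ℂ s (ball 0 1)) (hs1 : ∀ z, ‖z‖ < 1 → ‖s z‖ ≤ 1) :
    DifferentiableOn ℂ (fun z => s z * dslope P 0 (z * s z)) (ball 0 1) :=
  hs.mul ((differentiableOn_dslope_zero hP).comp (differentiableOn_id.mul hs) fun z hz => by
    rw [mem_ball_zero_iff] at hz ⊢
    change ‖z * s z‖ < 1
    rw [mul_comm]
    exact norm_mul_lt_one (hs1 z hz) hz)

theorem deriv_deriv_eq_of_exp {f L l : ℂ → ℂ} (hL : ∀ z, ‖z‖ < 1 → HasDerivAt L (l z) z)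
    (hf : ∀ z, ‖z‖ < 1 → exp (L z) = deriv f z) {z : ℂ} (hz : ‖z‖ < 1) :
    deriv (deriv f) z = exp (L z) * l z := by
  have h1 : deriv f =ᶠ[𝓝 z] fun z => exp (L z) := by
    filter_upwards [isOpen_ball.mem_nhds (mem_ball_zero_iff.2 hz)] with w hw
    exact (hf w (mem_ball_zero_iff.1 hw)).symm
  rw [h1.deriv_eq]
  exact (hL z hz).cexp.deriv

theorem taylorCoeff_two (f : ℂ → ℂ) : taylorCoeff 2 f = deriv (deriv f) 0 / 2 := by
  rw [taylorCoeff, iteratedDeriv_succ, iteratedDeriv_one]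
  norm_num

/-- The function `P⁻¹ (1 + z L')` is a self-map of the disk fixing `0`; `s` is its quotient by `z`.
Evaluating `L'` at `0` identifies `s 0`. -/
theorem IsCV.exists_schwarz (hP : IsConformalOnto P Ω) (hP0 : P 0 = 1) {f L : ℂ → ℂ}
    (hf : IsCV Ω f) (hL : IsLogDeriv f L) :
    ∃ s : ℂ → ℂ, DifferentiableOn ℂ s (ball 0 1) ∧ (∀ z, ‖z‖ < 1 → ‖s z‖ ≤ 1) ∧
      s 0 = 2 * taylorCoeff 2 f / deriv P 0 ∧
      ∀ z, ‖z‖ < 1 → HasDerivAt L (s z * dslope P 0 (z * s z)) z := by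
  obtain ⟨S, hS, hSD, hSK, hKS⟩ := hP.exists_inverse
  have hLd : ∀ z, ‖z‖ < 1 → HasDerivAt L (deriv L z) z := fun z hz =>
    hasDerivAt_of_norm_lt hL.differentiableOn hz
  have hexp : ∀ z, ‖z‖ < 1 → exp (L z) = deriv f z := fun z hz =>
    hL.exp_eq z (mem_ball_zero_iff.2 hz)
  have hmem : ∀ z ∈ ball (0 : ℂ) 1, 1 + z * deriv L z ∈ Ω := by
    intro z hz
    have h1 := hf.mem z hz
    rw [mem_ball_zero_iff] at hz
    rwa [deriv_deriv_eq_of_exp hLd hexp hz, ← hexp z hz, mul_div_cancel_left₀ _ (exp_ne_zero _)]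
      at h1
  have hL' : DifferentiableOn ℂ (deriv L) (ball 0 1) := hL.differentiableOn.deriv isOpen_ball
  set ω : ℂ → ℂ := fun z => S (1 + z * deriv L z) with hω
  have hωd : DifferentiableOn ℂ ω (ball 0 1) :=
    hS.comp ((differentiableOn_id.mul hL').const_add 1) hmem
  have hω0 : ω 0 = 0 := by
    have := hSK 0 (by simp)
    rw [hP0] at this
    simp [hω, this]
  have hs := differentiableOn_dslope_zero hωd
  have hs1 : ∀ z, ‖z‖ < 1 → ‖dslope ω 0 z‖ ≤ 1 := fun z hz => by
    simpa using norm_dslope_le_div_of_mapsTo_ball (R₂ := 1) hωd (fun w hw => by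
      rw [hω0]; exact ball_subset_closedBall (hSD (hmem w hw))) (mem_ball_zero_iff.2 hz)
  have hzs : ∀ z, z * dslope ω 0 z = ω z := fun z => by
    rw [← sub_eq_mul_dslope, hω0, sub_zero]
  have hder : ∀ z, ‖z‖ < 1 → deriv L z = dslope ω 0 z * dslope P 0 (z * dslope ω 0 z) := by
    intro z hz
    refine eqOn_ball_of_ne_zero (h := deriv L)
      (k := fun z => dslope ω 0 z * dslope P 0 (z * dslope ω 0 z)) hL'.continuousOn
      (differentiableOn_mul_dslope hP.differentiableOn hs hs1).continuousOn
      (fun z hz hz0 => mul_left_cancel₀ hz0 ?_) hz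
    rw [← mul_assoc, hzs, ← sub_eq_mul_dslope, hP0, hω]
    simp only
    rw [hKS _ (hmem z (mem_ball_zero_iff.2 hz))]
    ring
  refine ⟨dslope ω 0, hs, hs1, ?_, fun z hz => hder z hz ▸ hLd z hz⟩
  have h0 := hder 0 (by simp)
  have hP' := hP.deriv_ne_zero (z := 0) (by simp)
  rw [zero_mul, dslope_same P] at h0
  rw [taylorCoeff_two, deriv_deriv_eq_of_exp hLd hexp (by simp), hL.map_zero, exp_zero, h0]
  field_simp

theorem isCV_of_hasDerivAt_exp (hP : IsConformalOnto P Ω) (hP0 : P 0 = 1) {f L s : ℂ → ℂ}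
    (hs1 : ∀ z, ‖z‖ < 1 → ‖s z‖ ≤ 1)
    (hL : ∀ z, ‖z‖ < 1 → HasDerivAt L (s z * dslope P 0 (z * s z)) z) (hL0 : L 0 = 0)
    (hf : ∀ z, ‖z‖ < 1 → HasDerivAt f (exp (L z)) z) (hf0 : f 0 = 0) :
    IsCV Ω f ∧ IsLogDeriv f L ∧ taylorCoeff 2 f = s 0 * deriv P 0 / 2 := by
  have hexp : ∀ z, ‖z‖ < 1 → exp (L z) = deriv f z := fun z hz => (hf z hz).deriv.symm
  refine ⟨⟨fun z hz => ?_, hf0, ?_, fun z hz => ?_, fun z hz => ?_⟩,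
    ⟨fun z hz => ?_, hL0, fun z hz => ?_⟩, ?_⟩
  · exact (hf z (mem_ball_zero_iff.1 hz)).differentiableAt.differentiableWithinAt
  · rw [← hexp 0 (by simp), hL0, exp_zero]
  · rw [← hexp z (mem_ball_zero_iff.1 hz)]
    exact exp_ne_zero _
  · rw [mem_ball_zero_iff] at hz
    rw [deriv_deriv_eq_of_exp hL hexp hz, ← hexp z hz, mul_div_cancel_left₀ _ (exp_ne_zero _),
      ← mul_assoc, ← sub_eq_mul_dslope, hP0, add_sub_cancel]
    refine hP.mem ?_
    rw [mul_comm]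
    exact norm_mul_lt_one (hs1 z hz) hz
  · exact (hL z (mem_ball_zero_iff.1 hz)).differentiableAt.differentiableWithinAt
  · exact hexp z (mem_ball_zero_iff.1 hz)
  · rw [taylorCoeff_two, deriv_deriv_eq_of_exp hL hexp (by simp), hL0, exp_zero, zero_mul,
      dslope_same, one_mul]

end Parametrization

theorem eq_const_of_norm_eq_one {s : ℂ → ℂ} (hs : DifferentiableOn ℂ s (ball 0 1))
    (hs1 : ∀ z, ‖z‖ < 1 → ‖s z‖ ≤ 1) {w : ℂ} (hw : ‖w‖ < 1) (hw1 : ‖s w‖ = 1) {z : ℂ}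
    (hz : ‖z‖ < 1) : s z = s w :=
  eq_const_of_exists_max hs (mem_ball_zero_iff.2 hw)
    (fun v hv => by simpa [hw1] using hs1 v (mem_ball_zero_iff.1 hv)) (mem_ball_zero_iff.2 hz)

/-- The Schwarz lemma for `σ_{-s(0)} ∘ s`. Interior values have `|s| < 1`, for otherwise `s` would
be constant of modulus one. -/
theorem exists_eq_sigma {s : ℂ → ℂ} (hs : DifferentiableOn ℂ s (ball 0 1))
    (hs1 : ∀ z, ‖z‖ < 1 → ‖s z‖ ≤ 1) (hγ : ‖s 0‖ < 1) :
    ∃ φ : ℂ → ℂ, DifferentiableOn ℂ φ (ball 0 1) ∧ (∀ z, ‖z‖ < 1 → ‖φ z‖ ≤ 1) ∧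
      ∀ z, ‖z‖ < 1 → s z = sigma (s 0) (φ z * z) := by
  have hlt : ∀ z, ‖z‖ < 1 → ‖s z‖ < 1 := fun z hz => (hs1 z hz).lt_of_ne fun h => by
    rw [eq_const_of_norm_eq_one hs hs1 hz h (z := 0) (by simp), h] at hγ
    exact lt_irrefl _ hγ
  have hγ' : ‖-s 0‖ < 1 := by simpa using hγ
  set ψ : ℂ → ℂ := fun z => sigma (-s 0) (s z) with hψ
  have hψd : DifferentiableOn ℂ ψ (ball 0 1) := fun z hz => by
    have hz' := mem_ball_zero_iff.1 hz
    exact ((hasDerivAt_sigma (one_add_conj_mul_ne_zero hγ' (hlt z hz').le)).comp z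
      (hasDerivAt_of_norm_lt hs hz')).differentiableAt.differentiableWithinAt
  have hψ0 : ψ 0 = 0 := by simp [hψ, sigma]
  refine ⟨dslope ψ 0, differentiableOn_dslope_zero hψd, fun z hz => ?_, fun z hz => ?_⟩
  · simpa using norm_dslope_le_div_of_mapsTo_ball (R₂ := 1) hψd (fun w hw => by
      rw [hψ0, mem_closedBall_zero_iff]
      exact (norm_sigma_lt_one hγ' (hlt w (mem_ball_zero_iff.1 hw))).le) (mem_ball_zero_iff.2 hz)
  · rw [mul_comm, ← sub_eq_mul_dslope, hψ0, sub_zero, hψ]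
    simpa using (sigma_neg_sigma hγ' (hlt z hz)).symm

/-- The derivative of `P (z σ_γ (ε z))` with respect to `ε`, divided by `z²`. -/
def derivKernel (P : ℂ → ℂ) (γ ε z : ℂ) : ℂ :=
  deriv P (z * sigma γ (ε * z)) * ((1 - normSq γ) / (1 + (starRingEnd ℂ) γ * (ε * z)) ^ 2)

/-! ### Analyticity of `Q` in `ε`. -/

theorem inv_mul_sub_one_eq {P : ℂ → ℂ} (hP0 : P 0 = 1) {z : ℂ} (hz0 : z ≠ 0) (x : ℂ) :
    z⁻¹ * (P (z * x) - 1) = x * dslope P 0 (z * x) := by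
  rw [← hP0, sub_eq_mul_dslope]
  field_simp

theorem Q_eq_segInt {P : ℂ → ℂ} (hP0 : P 0 = 1) (γ ε : ℂ) {z : ℂ} (hz : ‖z‖ < 1) :
    Q P γ z ε = segInt (fun ζ => sigma γ (ε * ζ) * dslope P 0 (ζ * sigma γ (ε * ζ))) z :=
  segInt_congr (fun _ _ hz0 => inv_mul_sub_one_eq hP0 hz0 _) hz

/-- Differentiation under the integral sign. The condition `‖ε‖ * ‖z‖ < 1` allows `ε` in a disk
strictly larger than the closed unit disk. -/
theorem hasDerivAt_Q {P : ℂ → ℂ} (hP : DifferentiableOn ℂ P (ball 0 1)) (hP0 : P 0 = 1)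
    {γ z ε : ℂ} (hγ : ‖γ‖ < 1) (hz : ‖z‖ < 1) (hz0 : z ≠ 0) (hε : ‖ε‖ * ‖z‖ < 1) :
    HasDerivAt (Q P γ z) (segInt (fun ζ => ζ * derivKernel P γ ε ζ) z) ε := by
  have hnz : 0 < ‖z‖ := norm_pos_iff.2 hz0
  obtain ⟨r, hεr, hr⟩ := exists_between ((lt_div_iff₀ hnz).2 hε)
  rw [lt_div_iff₀ hnz] at hr
  set K : Set (ℂ × ℝ) := closedBall (0 : ℂ) r ×ˢ Icc (0 : ℝ) 1 with hK
  have hKc : IsCompact K := (isCompact_closedBall 0 r).prod isCompact_Icc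
  have hx : ∀ p ∈ K, ‖p.1 * (p.2 * z)‖ < 1 := by
    rintro ⟨x, t⟩ ⟨hx, ht⟩
    rw [mem_closedBall_zero_iff] at hx
    have h1 : ‖(t : ℂ)‖ ≤ 1 := by rw [norm_real, Real.norm_of_nonneg ht.1]; exact ht.2
    have h2 : ‖(t : ℂ) * z‖ ≤ ‖z‖ := by
      rw [norm_mul]; exact mul_le_of_le_one_left hnz.le h1
    rw [norm_mul]
    exact (mul_le_mul hx h2 (norm_nonneg _) ((norm_nonneg x).trans hx)).trans_lt hr
  have hden : ∀ p ∈ K, 1 + (starRingEnd ℂ) γ * (p.1 * (p.2 * z)) ≠ 0 := fun p hp =>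
    one_add_conj_mul_ne_zero hγ (hx p hp).le
  have hσ : ContinuousOn (fun p : ℂ × ℝ => sigma γ (p.1 * (p.2 * z))) K :=
    ContinuousOn.div (by fun_prop) (by fun_prop) hden
  have hW : ContinuousOn (fun p : ℂ × ℝ => p.2 * z * sigma γ (p.1 * (p.2 * z))) K :=
    ContinuousOn.mul (by fun_prop) hσ
  have hWm : MapsTo (fun p : ℂ × ℝ => p.2 * z * sigma γ (p.1 * (p.2 * z))) K (ball 0 1) :=
    fun p hp => mem_ball_zero_iff.2
      (norm_mul_sigma_lt_one hγ (norm_ofReal_mul_lt_one hz hp.2) (hx p hp))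
  -- The `dslope` form keeps the integrand jointly continuous up to `t = 0`.
  set F : ℂ → ℝ → ℂ := fun x t => sigma γ (x * (t * z)) *
    dslope P 0 (t * z * sigma γ (x * (t * z))) * z with hF
  set F' : ℂ → ℝ → ℂ := fun x t => t * z * derivKernel P γ x (t * z) * z with hF'
  have hFc : ContinuousOn (fun p : ℂ × ℝ => F p.1 p.2) K :=
    (hσ.mul ((differentiableOn_dslope_zero hP).continuousOn.comp hW hWm)).mul continuousOn_const
  have hF'c : ContinuousOn (fun p : ℂ × ℝ => F' p.1 p.2) K := by
    refine ContinuousOn.mul (ContinuousOn.mul (by fun_prop) (ContinuousOn.mul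
      ((hP.deriv isOpen_ball).continuousOn.comp hW hWm) (ContinuousOn.div (by fun_prop)
        (by fun_prop) fun p hp => pow_ne_zero 2 (hden p hp)))) continuousOn_const
  have hslice : ∀ x : ℂ, ‖x‖ ≤ r → ∀ g : ℂ → ℝ → ℂ, ContinuousOn (fun p : ℂ × ℝ => g p.1 p.2) K →
      ContinuousOn (g x) (Icc 0 1) := fun x hx g hg =>
    hg.comp (f := fun t : ℝ => (x, t)) (by fun_prop) fun t ht =>
      ⟨mem_closedBall_zero_iff.2 hx, ht⟩
  have hmeas : ∀ g : ℝ → ℂ, ContinuousOn g (Icc 0 1) → MeasureTheory.AEStronglyMeasurable g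
      (MeasureTheory.volume.restrict (uIoc (0 : ℝ) 1)) := fun g hg => by
    rw [uIoc_of_le zero_le_one]
    exact (hg.mono Ioc_subset_Icc_self).aestronglyMeasurable measurableSet_Ioc
  obtain ⟨C, hC⟩ := hKc.exists_bound_of_continuousOn hF'c
  have hball : ball (0 : ℂ) r ∈ 𝓝 ε := isOpen_ball.mem_nhds (mem_ball_zero_iff.2 hεr)
  have key := (intervalIntegral.hasDerivAt_integral_of_dominated_loc_of_deriv_le
    (F := F) (F' := F') (bound := fun _ => C) (a := 0) (b := 1) (x₀ := ε)
    (μ := MeasureTheory.volume) hball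
    (by filter_upwards [hball] with x hx using
      hmeas _ (hslice x (mem_ball_zero_iff.1 hx).le F hFc))
    (ContinuousOn.intervalIntegrable (by
      rw [uIcc_of_le zero_le_one]; exact hslice ε hεr.le F hFc))
    (hmeas _ (hslice ε hεr.le F' hF'c))
    (Eventually.of_forall fun t ht x hx => by
      rw [uIoc_of_le zero_le_one] at ht
      exact hC (x, t) ⟨ball_subset_closedBall hx, ⟨ht.1.le, ht.2⟩⟩)
    intervalIntegrable_const
    (Eventually.of_forall fun t ht x hx' => by
      rw [uIoc_of_le zero_le_one] at ht
      have hxK : (x, t) ∈ K := ⟨ball_subset_closedBall hx', ⟨ht.1.le, ht.2⟩⟩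
      have htz : (t : ℂ) * z ≠ 0 := mul_ne_zero (ofReal_ne_zero.2 ht.1.ne') hz0
      have hFe : (fun x => F x t) = fun x =>
          ((t : ℂ) * z)⁻¹ * (P (t * z * sigma γ (x * (t * z))) - 1) * z := by
        funext x
        simp only [hF]
        rw [inv_mul_sub_one_eq hP0 htz]
      rw [hFe]
      have h1 : HasDerivAt (fun x : ℂ => x * (t * z)) (t * z) x := by
        simpa using (hasDerivAt_id' x).mul_const ((t : ℂ) * z)
      have h2 := ((hasDerivAt_sigma (hden _ hxK)).comp x h1).const_mul ((t : ℂ) * z)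
      have h3 := (hasDerivAt_of_norm_lt hP (mem_ball_zero_iff.1 (hWm hxK))).comp x h2
      convert! ((h3.sub_const 1).const_mul ((t : ℂ) * z)⁻¹).mul_const z using 1
      simp only [hF', derivKernel]
      field_simp)).2
  refine key.congr_of_eventuallyEq (Eventually.of_forall fun x => ?_)
  exact Q_eq_segInt hP0 γ x hz

theorem analyticOnNhd_Q {P : ℂ → ℂ} (hP : DifferentiableOn ℂ P (ball 0 1)) (hP0 : P 0 = 1)
    {γ z : ℂ} (hγ : ‖γ‖ < 1) (hz : ‖z‖ < 1) (hz0 : z ≠ 0) :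
    AnalyticOnNhd ℂ (Q P γ z) (closedBall 0 1) := by
  have hnz : 0 < ‖z‖ := norm_pos_iff.2 hz0
  have h1 : DifferentiableOn ℂ (Q P γ z) (ball 0 (1 / ‖z‖)) := fun ε hε => by
    rw [mem_ball_zero_iff, lt_div_iff₀ hnz] at hε
    exact (hasDerivAt_Q hP hP0 hγ hz hz0 hε).differentiableAt.differentiableWithinAt
  exact (h1.analyticOnNhd isOpen_ball).mono
    (closedBall_subset_ball ((lt_div_iff₀ hnz).2 (by simpa using hz)))

/-! ### The tangent half-plane inequality. -/

/-- Here `z² G` is `∂_ε Q`, the denominator for Libera's lemma. Its starlikeness also shows that it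
does not vanish off the origin. -/
theorem IsConformalOnto.exists_starlike {P : ℂ → ℂ} {Ω : Set ℂ} (hP : IsConformalOnto P Ω)
    (hΩ : Convex ℝ Ω) {γ ε : ℂ} (hγ : ‖γ‖ < 1) (hε : ‖ε‖ ≤ 1) :
    ∃ G : ℂ → ℂ, DifferentiableOn ℂ G (ball 0 1) ∧
      (∀ z, ‖z‖ < 1 → derivKernel P γ ε z = 2 * G z + z * deriv G z) ∧
      (∀ z, ‖z‖ < 1 → 0 < (G z / derivKernel P γ ε z).re) ∧
      ∀ z, ‖z‖ < 1 → segInt (fun ζ => ζ * derivKernel P γ ε ζ) z = z ^ 2 * G z := by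
  have h1 : ∀ z : ℂ, ∃ d : ℂ, ‖z‖ < 1 → HasDerivAt (derivKernel P γ ε) d z ∧
      0 < (2 + z * (d / derivKernel P γ ε z)).re := by
    intro z
    by_cases hz : ‖z‖ < 1
    · obtain ⟨d, hd⟩ := hP.exists_hasDerivAt_re_pos hΩ hγ hz hε
      exact ⟨d, fun _ => hd⟩
    · exact ⟨0, fun h => absurd h hz⟩
  choose d hd using h1
  have hgd : DifferentiableOn ℂ (derivKernel P γ ε) (ball 0 1) := fun z hz =>
    (hd z (mem_ball_zero_iff.1 hz)).1.differentiableAt.differentiableWithinAt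
  obtain ⟨G, hG, hgG, hint⟩ := exists_two_mul_add hgd
  refine ⟨G, hG, hgG, fun z hz => ?_, hint⟩
  refine re_div_pos_of_convex (fun z hz => hasDerivAt_of_norm_lt hG hz) (fun z hz => (hd z hz).1)
    hgG (fun z hz => ?_) (fun z hz => (hd z hz).2) hz
  have hεz := norm_mul_lt_one hε hz
  exact mul_ne_zero (hP.deriv_ne_zero (norm_mul_sigma_lt_one hγ hz hεz))
    (div_ne_zero (one_sub_normSq_ne_zero hγ)
      (pow_ne_zero 2 (one_add_conj_mul_ne_zero hγ hεz.le)))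

theorem differentiableOn_sigma_mul {γ : ℂ} (hγ : ‖γ‖ < 1) {φ : ℂ → ℂ}
    (hφ : DifferentiableOn ℂ φ (ball 0 1)) (hφ1 : ∀ z, ‖z‖ < 1 → ‖φ z‖ ≤ 1) :
    DifferentiableOn ℂ (fun z => sigma γ (φ z * z)) (ball 0 1) := fun z hz => by
  have hz' := mem_ball_zero_iff.1 hz
  have h1 := hasDerivAt_sigma (one_add_conj_mul_ne_zero hγ (norm_mul_lt_one (hφ1 z hz') hz').le)
  have h2 := (hasDerivAt_of_norm_lt hφ hz').fun_mul (hasDerivAt_id' z)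
  exact (h1.differentiableAt.comp (f := fun z => φ z * z) z
    h2.differentiableAt).differentiableWithinAt

theorem norm_sigma_mul_le {γ : ℂ} (hγ : ‖γ‖ < 1) {φ : ℂ → ℂ} (hφ1 : ∀ z, ‖z‖ < 1 → ‖φ z‖ ≤ 1)
    (z : ℂ) (hz : ‖z‖ < 1) : ‖sigma γ (φ z * z)‖ ≤ 1 :=
  (norm_sigma_lt_one hγ (norm_mul_lt_one (hφ1 z hz) hz)).le

/-- The values at `z` of the functions parametrized by `φ` with `‖φ‖ ≤ ‖ε‖` lie in the half plane
bounded by the tangent at `ε` of `Q P γ z` on the circle of radius `‖ε‖`. -/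
theorem IsConformalOnto.re_sub_Q_div_nonpos {P : ℂ → ℂ} {Ω : Set ℂ} (hP : IsConformalOnto P Ω)
    (hΩ : Convex ℝ Ω) (hP0 : P 0 = 1) {γ ε : ℂ} (hγ : ‖γ‖ < 1) (hε : ‖ε‖ ≤ 1) (hε0 : ε ≠ 0)
    {φ L : ℂ → ℂ} (hφ : DifferentiableOn ℂ φ (ball 0 1)) (hφε : ∀ z, ‖z‖ < 1 → ‖φ z‖ ≤ ‖ε‖)
    (hL : ∀ z, ‖z‖ < 1 →
      HasDerivAt L (sigma γ (φ z * z) * dslope P 0 (z * sigma γ (φ z * z))) z)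
    (hL0 : L 0 = 0) {z : ℂ} (hz : ‖z‖ < 1) (hz0 : z ≠ 0) :
    ((L z - Q P γ z ε) / (ε * segInt (fun ζ => ζ * derivKernel P γ ε ζ) z)).re ≤ 0 ∧
      (((L z - Q P γ z ε) / (ε * segInt (fun ζ => ζ * derivKernel P γ ε ζ) z)).re = 0 →
        ∀ w, ‖w‖ < 1 → w ≠ 0 → φ w = ε) := by
  obtain ⟨G, hG, hgG, hGg, hint⟩ := hP.exists_starlike hΩ hγ hε
  have hφ1 : ∀ z, ‖z‖ < 1 → ‖φ z‖ ≤ 1 := fun z hz => (hφε z hz).trans hε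
  set hφf : ℂ → ℂ := fun z => sigma γ (φ z * z) * dslope P 0 (z * sigma γ (φ z * z)) with hh1
  set hεf : ℂ → ℂ := fun z => sigma γ (ε * z) * dslope P 0 (z * sigma γ (ε * z)) with hh2
  have hd1 : DifferentiableOn ℂ hφf (ball 0 1) :=
    differentiableOn_mul_dslope hP.differentiableOn (differentiableOn_sigma_mul hγ hφ hφ1)
      (norm_sigma_mul_le hγ hφ1)
  have hd2 : DifferentiableOn ℂ hεf (ball 0 1) :=
    differentiableOn_mul_dslope hP.differentiableOn
      (differentiableOn_sigma_mul (φ := fun _ => ε) hγ (differentiableOn_const ε) fun _ _ => hε)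
      (norm_sigma_mul_le (φ := fun _ => ε) hγ fun _ _ => hε)
  -- `k` is the derivative of `(L - Q) / ε`. It vanishes at `0` since `σ_γ (φ z * z)` takes the
  -- value `γ` there for every `φ`; hence `(L - Q) / ε` has the form `z² A`.
  set k : ℂ → ℂ := fun z => (hφf z - hεf z) / ε with hk
  have hkd : DifferentiableOn ℂ k (ball 0 1) := (hd1.sub hd2).div_const ε
  have hk0 : k 0 = 0 := by simp [hk, hh1, hh2]
  have hzk : ∀ z, z * dslope k 0 z = k z := fun z => by
    rw [← sub_eq_mul_dslope, hk0, sub_zero]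
  obtain ⟨A, hA, haA, hAint⟩ := exists_two_mul_add (differentiableOn_dslope_zero hkd)
  have hAe : ∀ z, ‖z‖ < 1 → z ^ 2 * A z = (L z - Q P γ z ε) / ε := by
    intro z hz
    rw [← hAint z hz]
    simp only [hzk]
    have h1 : ∀ z, ‖z‖ < 1 → HasDerivAt (fun z => (L z - segInt hεf z) / ε) (k z) z := fun z hz =>
      ((hL z hz).sub (hasDerivAt_segInt hd2 hz)).div_const ε
    rw [← eq_segInt_of_hasDerivAt hkd.continuousOn h1 (by simp [hL0, segInt_zero]) hz,
      Q_eq_segInt hP0 γ ε hz]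
  -- The quotient of derivatives depends on `φ` only through `φ w`, so the pointwise estimate
  -- applies with `b = φ w`.
  have hratio : ∀ w, ‖w‖ < 1 → w ≠ 0 → dslope k 0 w / derivKernel P γ ε w =
      (P (w * sigma γ (φ w * w)) - P (w * sigma γ (ε * w))) / (ε * (w ^ 2 * (deriv P
        (w * sigma γ (ε * w)) * ((1 - normSq γ) / (1 + (starRingEnd ℂ) γ * (ε * w)) ^ 2)))) := by
    intro w hw hw0
    have h1 : P (w * sigma γ (φ w * w)) - P (w * sigma γ (ε * w)) =
        ε * w ^ 2 * dslope k 0 w := by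
      have h2 := sub_eq_mul_dslope P (w * sigma γ (φ w * w))
      have h3 := sub_eq_mul_dslope P (w * sigma γ (ε * w))
      have h4 : ε * k w = hφf w - hεf w := by simp only [hk]; field_simp
      rw [← hzk] at h4
      simp only [hh1, hh2] at h4
      linear_combination h2 - h3 - w * h4
    rw [h1, ← derivKernel, mul_assoc, mul_div_mul_left _ _ hε0,
      mul_div_mul_left _ _ (pow_ne_zero 2 hw0)]
  have hlt : ∀ w, ‖w‖ < 1 → w ≠ 0 → φ w ≠ ε → (dslope k 0 w / derivKernel P γ ε w).re < 0 :=
    fun w hw hw0 hne => by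
      rw [hratio w hw hw0]
      exact hP.re_div_neg hΩ hγ hw hw0 hε hε0 (hφε w hw) hne
  have hle : ∀ w, ‖w‖ < 1 → w ≠ 0 → (dslope k 0 w / derivKernel P γ ε w).re ≤ 0 :=
    fun w hw hw0 => by
      by_cases h : φ w = ε
      · rw [hratio w hw hw0, h, sub_self, zero_div, zero_re]
      · exact (hlt w hw hw0 h).le
  have hmain := re_div_nonpos_of_starlike (fun z hz => hasDerivAt_of_norm_lt hA hz)
    (fun z hz => hasDerivAt_of_norm_lt hG hz) haA hgG hGg hle hz
  have hval : (L z - Q P γ z ε) / (ε * segInt (fun ζ => ζ * derivKernel P γ ε ζ) z) =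
      A z / G z := by
    rw [hint z hz, ← div_div, ← hAe z hz, mul_div_mul_left _ _ (pow_ne_zero 2 hz0)]
  rw [hval]
  refine ⟨hmain.1, fun h w hw hw0 => ?_⟩
  by_contra hne
  exact (hlt w hw hw0 hne).ne (hmain.2 h w hw hw0)

theorem IsConformalOnto.segInt_derivKernel_ne_zero {P : ℂ → ℂ} {Ω : Set ℂ}
    (hP : IsConformalOnto P Ω) (hΩ : Convex ℝ Ω) {γ ε : ℂ} (hγ : ‖γ‖ < 1) (hε : ‖ε‖ ≤ 1)
    {z : ℂ} (hz : ‖z‖ < 1) (hz0 : z ≠ 0) : segInt (fun ζ => ζ * derivKernel P γ ε ζ) z ≠ 0 := by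
  obtain ⟨G, -, -, hGg, hint⟩ := hP.exists_starlike hΩ hγ hε
  rw [hint z hz]
  exact mul_ne_zero (pow_ne_zero 2 hz0) fun h => by simpa [h] using hGg z hz

theorem hasDerivAt_Q_left {P : ℂ → ℂ} (hP : DifferentiableOn ℂ P (ball 0 1)) (hP0 : P 0 = 1)
    {γ ε : ℂ} (hγ : ‖γ‖ < 1) (hε : ‖ε‖ ≤ 1) {z : ℂ} (hz : ‖z‖ < 1) :
    HasDerivAt (fun z => Q P γ z ε)
      (sigma γ (ε * z) * dslope P 0 (z * sigma γ (ε * z))) z := by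
  have hd : DifferentiableOn ℂ
      (fun z => sigma γ (ε * z) * dslope P 0 (z * sigma γ (ε * z))) (ball 0 1) :=
    differentiableOn_mul_dslope hP
      (differentiableOn_sigma_mul (φ := fun _ => ε) hγ (differentiableOn_const ε) fun _ _ => hε)
      (norm_sigma_mul_le (φ := fun _ => ε) hγ fun _ _ => hε)
  refine (hasDerivAt_segInt hd hz).congr_of_eventuallyEq ?_
  filter_upwards [isOpen_ball.mem_nhds (mem_ball_zero_iff.2 hz)] with w hw
  exact Q_eq_segInt hP0 γ ε (mem_ball_zero_iff.1 hw)

theorem Q_zero (P : ℂ → ℂ) (γ ε : ℂ) : Q P γ 0 ε = 0 := segInt_zero _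

theorem IsConformalOnto.re_Q_sub_Q_neg {P : ℂ → ℂ} {Ω : Set ℂ} (hP : IsConformalOnto P Ω)
    (hΩ : Convex ℝ Ω) (hP0 : P 0 = 1) {γ : ℂ} (hγ : ‖γ‖ < 1) {z : ℂ} (hz : ‖z‖ < 1)
    (hz0 : z ≠ 0) (ε b : ℂ) (hε : ‖ε‖ ≤ 1) (hb : ‖b‖ ≤ ‖ε‖) (hne : b ≠ ε) :
    ((Q P γ z b - Q P γ z ε) / (ε * segInt (fun ζ => ζ * derivKernel P γ ε ζ) z)).re < 0 := by
  have hε0 : ε ≠ 0 := by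
    rintro rfl
    rw [norm_zero, norm_le_zero_iff] at hb
    exact hne hb
  have h := hP.re_sub_Q_div_nonpos hΩ hP0 hγ hε hε0 (φ := fun _ => b) (L := fun z => Q P γ z b)
    (differentiableOn_const b) (fun _ _ => hb)
    (fun w hw => hasDerivAt_Q_left hP.differentiableOn hP0 hγ (hb.trans hε) hw)
    (Q_zero P γ b) hz hz0
  exact h.1.lt_of_ne fun h0 => hne (h.2 h0 z hz hz0)

/-! ### The variability region and its boundary functions. -/

theorem IsLogDeriv.eq_segInt {Ω : Set ℂ} {f L l : ℂ → ℂ} (hf : IsCV Ω f) (hL : IsLogDeriv f L)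
    (hl : DifferentiableOn ℂ l (ball 0 1)) (hLl : ∀ z, ‖z‖ < 1 → L z = l z) {z : ℂ}
    (hz : ‖z‖ < 1) : f z = segInt (fun ζ => exp (l ζ)) z := by
  refine eq_segInt_of_hasDerivAt hl.cexp.continuousOn (fun w hw => ?_) hf.map_zero hz
  rw [← hLl w hw, hL.exp_eq w (mem_ball_zero_iff.2 hw)]
  exact hasDerivAt_of_norm_lt hf.differentiableOn hw

theorem hasDerivAt_of_eq_segInt_exp {f l : ℂ → ℂ} (hl : DifferentiableOn ℂ l (ball 0 1))
    (hf : ∀ z, ‖z‖ < 1 → f z = segInt (fun ζ => exp (l ζ)) z) {z : ℂ} (hz : ‖z‖ < 1) :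
    HasDerivAt f (exp (l z)) z := by
  refine (hasDerivAt_segInt hl.cexp hz).congr_of_eventuallyEq ?_
  filter_upwards [isOpen_ball.mem_nhds (mem_ball_zero_iff.2 hz)] with w hw
  exact hf w (mem_ball_zero_iff.1 hw)

/-- When `|s 0| = |γ| = 1`, the maximum principle makes `s` the constant `γ`. -/
theorem IsConformalOnto.variabilityRegion_eq_singleton {P : ℂ → ℂ} {Ω : Set ℂ}
    (hP : IsConformalOnto P Ω) (hP0 : P 0 = 1) {lam γ z₀ : ℂ} (hz₀ : ‖z₀‖ < 1)
    (hγ : γ = 2 * lam / deriv P 0) (hγ1 : ‖γ‖ = 1) :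
    variabilityRegion Ω z₀ lam = {segInt (fun ζ => ζ⁻¹ * (P (γ * ζ) - 1)) z₀} := by
  have hP' := hP.deriv_ne_zero (z := 0) (by simp)
  set l : ℂ → ℂ := fun z => γ * dslope P 0 (z * γ) with hl
  have hld : DifferentiableOn ℂ l (ball 0 1) :=
    differentiableOn_mul_dslope (s := fun _ => γ) hP.differentiableOn (differentiableOn_const γ)
      fun _ _ => hγ1.le
  have hint : segInt (fun ζ => ζ⁻¹ * (P (γ * ζ) - 1)) z₀ = segInt l z₀ :=
    segInt_congr (fun z _ hz0 => by rw [mul_comm γ, inv_mul_sub_one_eq hP0 hz0]) hz₀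
  rw [hint]
  ext w
  rw [mem_singleton_iff]
  constructor
  · rintro ⟨f, L, hf, hlam, hL, rfl⟩
    obtain ⟨s, hs, hs1, hs0, hLs⟩ := hf.exists_schwarz hP hP0 hL
    rw [hlam, ← hγ] at hs0
    refine eq_segInt_of_hasDerivAt hld.continuousOn (fun z hz => ?_) hL.map_zero hz₀
    have h1 := hLs z hz
    rwa [eq_const_of_norm_eq_one hs hs1 (w := 0) (by simp) (by rw [hs0, hγ1]) hz, hs0] at h1
  · rintro rfl
    have hLd : ∀ z, ‖z‖ < 1 → HasDerivAt (segInt l) (l z) z := fun z hz => hasDerivAt_segInt hld hz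
    have hLD : DifferentiableOn ℂ (segInt l) (ball 0 1) := fun z hz =>
      (hLd z (mem_ball_zero_iff.1 hz)).differentiableAt.differentiableWithinAt
    obtain ⟨h1, h2, h3⟩ := isCV_of_hasDerivAt_exp (s := fun _ => γ) hP hP0
      (fun _ _ => hγ1.le) hLd (segInt_zero l)
      (fun z hz => hasDerivAt_segInt hLD.cexp hz) (segInt_zero _)
    refine ⟨_, _, h1, ?_, h2, rfl⟩
    rw [h3, hγ]
    field_simp

theorem IsConformalOnto.isCV_of_eq_segInt_exp_Q {P : ℂ → ℂ} {Ω : Set ℂ}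
    (hP : IsConformalOnto P Ω) (hP0 : P 0 = 1) {lam γ b : ℂ} (hγ : γ = 2 * lam / deriv P 0)
    (hγ1 : ‖γ‖ < 1) (hb : ‖b‖ ≤ 1) {f : ℂ → ℂ}
    (hf : ∀ z, ‖z‖ < 1 → f z = segInt (fun ζ => exp (Q P γ ζ b)) z) :
    IsCV Ω f ∧ IsLogDeriv f (fun z => Q P γ z b) ∧ taylorCoeff 2 f = lam := by
  have hP' := hP.deriv_ne_zero (z := 0) (by simp)
  have hQ : ∀ z, ‖z‖ < 1 → HasDerivAt (fun z => Q P γ z b)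
      (sigma γ (b * z) * dslope P 0 (z * sigma γ (b * z))) z := fun z hz =>
    hasDerivAt_Q_left hP.differentiableOn hP0 hγ1 hb hz
  have hQd : DifferentiableOn ℂ (fun z => Q P γ z b) (ball 0 1) := fun z hz =>
    (hQ z (mem_ball_zero_iff.1 hz)).differentiableAt.differentiableWithinAt
  obtain ⟨h1, h2, h3⟩ := isCV_of_hasDerivAt_exp (s := fun z => sigma γ (b * z)) hP hP0
    (norm_sigma_mul_le (φ := fun _ => b) hγ1 fun _ _ => hb) hQ (Q_zero P γ b)
    (fun z hz => hasDerivAt_of_eq_segInt_exp hQd hf hz)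
    (by rw [hf 0 (by simp), segInt_zero])
  refine ⟨h1, h2, ?_⟩
  rw [h3, hγ, sigma]
  simp
  field_simp

theorem IsCV.exists_schwarz_sigma {P : ℂ → ℂ} {Ω : Set ℂ} (hP : IsConformalOnto P Ω)
    (hP0 : P 0 = 1) {f L : ℂ → ℂ} (hf : IsCV Ω f) (hL : IsLogDeriv f L) {γ : ℂ}
    (hγ : γ = 2 * taylorCoeff 2 f / deriv P 0) (hγ1 : ‖γ‖ < 1) :
    ∃ φ : ℂ → ℂ, DifferentiableOn ℂ φ (ball 0 1) ∧ (∀ z, ‖z‖ < 1 → ‖φ z‖ ≤ 1) ∧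
      ∀ z, ‖z‖ < 1 →
        HasDerivAt L (sigma γ (φ z * z) * dslope P 0 (z * sigma γ (φ z * z))) z := by
  obtain ⟨s, hs, hs1, hs0, hLs⟩ := hf.exists_schwarz hP hP0 hL
  rw [← hγ] at hs0
  obtain ⟨φ, hφ, hφ1, hsφ⟩ := exists_eq_sigma hs hs1 (by rwa [hs0])
  rw [hs0] at hsφ
  exact ⟨φ, hφ, hφ1, fun z hz => hsφ z hz ▸ hLs z hz⟩

/-- Each value `L z₀` lies in every tangent half plane of `Q P γ z₀` on the unit circle, hence is
covered; conversely each constant `φ = b` comes from a member of the class. -/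
theorem IsConformalOnto.variabilityRegion_eq_image {P : ℂ → ℂ} {Ω : Set ℂ}
    (hP : IsConformalOnto P Ω) (hΩ : Convex ℝ Ω) (hP0 : P 0 = 1) {lam γ z₀ : ℂ} (hz₀ : ‖z₀‖ < 1)
    (hz₀' : z₀ ≠ 0) (hγ : γ = 2 * lam / deriv P 0) (hγ1 : ‖γ‖ < 1) :
    variabilityRegion Ω z₀ lam = Q P γ z₀ '' closedBall 0 1 := by
  ext w
  constructor
  · rintro ⟨f, L, hf, rfl, hL, rfl⟩
    obtain ⟨φ, hφ, hφ1, hLφ⟩ := hf.exists_schwarz_sigma hP hP0 hL hγ hγ1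
    refine mem_image_closedBall_of_re_le (fun ε hε => hasDerivAt_Q hP.differentiableOn hP0 hγ1
      hz₀ hz₀' (by rw [← norm_mul]; exact norm_mul_lt_one hε hz₀))
      (fun ε hε => hP.segInt_derivKernel_ne_zero hΩ hγ1 hε.le hz₀ hz₀') fun ε hε => ?_
    have hε0 : ε ≠ 0 := norm_pos_iff.1 (hε ▸ one_pos)
    rw [re_mul_conj_nonpos_iff (mul_ne_zero hε0
      (hP.segInt_derivKernel_ne_zero hΩ hγ1 hε.le hz₀ hz₀'))]
    exact (hP.re_sub_Q_div_nonpos hΩ hP0 hγ1 hε.le hε0 hφ (by rwa [hε]) hLφ hL.map_zero hz₀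
      hz₀').1
  · rintro ⟨b, hb, rfl⟩
    rw [mem_closedBall_zero_iff] at hb
    obtain ⟨h1, h2, h3⟩ := hP.isCV_of_eq_segInt_exp_Q hP0 hγ hγ1 hb (fun _ _ => rfl)
    exact ⟨_, _, h1, h3, h2, rfl⟩

/-- The hypothesis on `L z₀` is equality in the half-plane inequality at `ε`, which forces `φ = ε`
off the origin. -/
theorem IsConformalOnto.eq_segInt_exp_Q {P : ℂ → ℂ} {Ω : Set ℂ}
    (hP : IsConformalOnto P Ω) (hΩ : Convex ℝ Ω) (hP0 : P 0 = 1) {γ z₀ ε : ℂ}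
    (hz₀ : ‖z₀‖ < 1) (hz₀' : z₀ ≠ 0) (hγ1 : ‖γ‖ < 1) (hε : ‖ε‖ = 1) {f L : ℂ → ℂ}
    (hγ : γ = 2 * taylorCoeff 2 f / deriv P 0)
    (hf : IsCV Ω f) (hL : IsLogDeriv f L) (hLε : L z₀ = Q P γ z₀ ε) {z : ℂ} (hz : ‖z‖ < 1) :
    f z = segInt (fun ζ => exp (Q P γ ζ ε)) z := by
  obtain ⟨φ, hφ, hφ1, hLφ⟩ := hf.exists_schwarz_sigma hP hP0 hL hγ hγ1
  have hε0 : ε ≠ 0 := norm_pos_iff.1 (hε ▸ one_pos)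
  have h1 := (hP.re_sub_Q_div_nonpos hΩ hP0 hγ1 hε.le hε0 hφ (by rwa [hε]) hLφ hL.map_zero hz₀
    hz₀').2 (by rw [hLε, sub_self, zero_div, zero_re])
  -- The value `φ 0` is irrelevant: only the product `φ w * w` enters `L'`.
  have h2 : ∀ w, ‖w‖ < 1 → φ w * w = ε * w := fun w hw => by
    rcases eq_or_ne w 0 with rfl | hw0
    · simp
    · rw [h1 w hw hw0]
  have hQ : ∀ w, ‖w‖ < 1 → HasDerivAt (fun z => Q P γ z ε)
      (sigma γ (ε * w) * dslope P 0 (w * sigma γ (ε * w))) w := fun w hw =>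
    hasDerivAt_Q_left hP.differentiableOn hP0 hγ1 hε.le hw
  have hQd : DifferentiableOn ℂ (fun z => Q P γ z ε) (ball 0 1) := fun w hw =>
    (hQ w (mem_ball_zero_iff.1 hw)).differentiableAt.differentiableWithinAt
  refine hL.eq_segInt hf hQd (fun w hw => ?_) hz
  rw [Q_eq_segInt hP0 γ ε hw]
  refine eq_segInt_of_hasDerivAt (differentiableOn_mul_dslope hP.differentiableOn
    (differentiableOn_sigma_mul (φ := fun _ => ε) hγ1 (differentiableOn_const ε) fun _ _ => hε.le)
    (norm_sigma_mul_le (φ := fun _ => ε) hγ1 fun _ _ => hε.le)).continuousOn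
    (fun v hv => ?_) hL.map_zero hw
  have h3 := hLφ v hv
  rwa [h2 v hv] at h3

end VarRegion

end

theorem mainTheorem3 (Ω : Set ℂ) (hΩo : IsOpen Ω) (hΩc : Convex ℝ Ω) (h1 : (1 : ℂ) ∈ Ω)
    (P : ℂ → ℂ) (hP : VarRegion.IsConformalOnto P Ω) (hP0 : P 0 = 1)
    (α₁ : ℂ) (hα₁ : HasDerivAt P α₁ 0)
    (lam : ℂ) (z₀ : ℂ) (hz₀ : z₀ ∈ Metric.ball (0 : ℂ) 1) (hz₀' : z₀ ≠ 0)
    (γ₁ : ℂ) (hγ₁ : γ₁ = 2 * lam / α₁) :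
    (‖lam‖ = ‖α₁‖ / 2 →
      VarRegion.variabilityRegion Ω z₀ lam =
        {VarRegion.segInt (fun ζ => ζ⁻¹ * (P (γ₁ * ζ) - 1)) z₀}) ∧
    (‖lam‖ < ‖α₁‖ / 2 →
      VarRegion.variabilityRegion Ω z₀ lam =
        VarRegion.Q P γ₁ z₀ '' Metric.closedBall (0 : ℂ) 1 ∧
      AnalyticOnNhd ℂ (VarRegion.Q P γ₁ z₀) (Metric.closedBall (0 : ℂ) 1) ∧
      Set.InjOn (VarRegion.Q P γ₁ z₀) (Metric.closedBall (0 : ℂ) 1) ∧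
      Convex ℝ (VarRegion.Q P γ₁ z₀ '' Metric.ball (0 : ℂ) 1) ∧
      Convex ℝ (VarRegion.Q P γ₁ z₀ '' Metric.closedBall (0 : ℂ) 1) ∧
      ∀ ε : ℂ, ‖ε‖ = 1 → ∀ f : ℂ → ℂ,
        (VarRegion.IsCV Ω f ∧ VarRegion.taylorCoeff 2 f = lam ∧
          ∃ L : ℂ → ℂ, VarRegion.IsLogDeriv f L ∧ L z₀ = VarRegion.Q P γ₁ z₀ ε) ↔
        ∀ z ∈ Metric.ball (0 : ℂ) 1,
          f z = VarRegion.segInt (fun ζ => Complex.exp (VarRegion.Q P γ₁ ζ ε)) z) := by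
  have hα : deriv P 0 = α₁ := hα₁.deriv
  subst hα
  have hα0 : 0 < ‖deriv P 0‖ := norm_pos_iff.2 (hP.deriv_ne_zero (by simp))
  have hnγ : ‖γ₁‖ = 2 * ‖lam‖ / ‖deriv P 0‖ := by rw [hγ₁]; simp
  rw [Metric.mem_ball, dist_zero_right] at hz₀
  refine ⟨fun hlam => ?_, fun hlam => ?_⟩
  · refine hP.variabilityRegion_eq_singleton hP0 hz₀ hγ₁ ?_
    rw [hnγ, hlam]
    field_simp
  have hγ1 : ‖γ₁‖ < 1 := by
    rw [hnγ, div_lt_one hα0]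
    linarith
  have hq : ∀ ε : ℂ, ‖ε‖ ≤ 1 → HasDerivAt (VarRegion.Q P γ₁ z₀)
      (VarRegion.segInt (fun ζ => ζ * VarRegion.derivKernel P γ₁ ε ζ) z₀) ε := fun ε hε =>
    VarRegion.hasDerivAt_Q hP.differentiableOn hP0 hγ1 hz₀ hz₀'
      (by rw [← norm_mul]; exact VarRegion.norm_mul_lt_one hε hz₀)
  have hq0 : ∀ ε : ℂ, ‖ε‖ ≤ 1 →
      VarRegion.segInt (fun ζ => ζ * VarRegion.derivKernel P γ₁ ε ζ) z₀ ≠ 0 := fun ε hε =>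
    hP.segInt_derivKernel_ne_zero hΩc hγ1 hε hz₀ hz₀'
  have hlt := hP.re_Q_sub_Q_neg hΩc hP0 hγ1 hz₀ hz₀'
  refine ⟨hP.variabilityRegion_eq_image hΩc hP0 hz₀ hz₀' hγ₁ hγ1,
    VarRegion.analyticOnNhd_Q hP.differentiableOn hP0 hγ1 hz₀ hz₀',
    VarRegion.injOn_closedBall_of_re_lt hlt,
    VarRegion.convex_image_ball_of_re_lt hq hq0 hlt,
    VarRegion.convex_image_closedBall_of_re_lt hq hq0 hlt, fun ε hε f => ⟨?_, fun hf => ?_⟩⟩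
  · rintro ⟨hf, hlam', L, hL, hLε⟩ z hz
    exact hP.eq_segInt_exp_Q hΩc hP0 hz₀ hz₀' hγ1 hε (by rw [hlam', hγ₁]) hf hL hLε
      (mem_ball_zero_iff.1 hz)
  · obtain ⟨h1, h2, h3⟩ := hP.isCV_of_eq_segInt_exp_Q hP0 hγ₁ hγ1 hε.le
      (fun z hz => hf z (mem_ball_zero_iff.2 hz))
    exact ⟨h1, h3, _, h2, rfl⟩
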